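/- Let $d\ge 1$, $n_1,\dots,n_d\in\mathbb N$ and $r_0,\dots,r_d\in\mathbb N$ with $r_0=r_d=1$. Let $E=\prod_{k=1}^d\mathbb R^{r_{k-1}\times n_k\times r_k}$ and let $\overline{\mathcal M}_r\subset E$ be the open set of all $\bar X=(X^1,\dots,X^d)$ such that for every $k$ the left unfolding $L(X^k)\in\mathbb R^{r_{k-1}n_k\times r_k}$ has rank $r_k$ and the right unfolding $R(X^k)\in\mathbb R^{r_{k-1}\times n_kr_k}$ has rank $r_{k-1}$; its tangent spaces are all $E$. For $\bar X\in E$ let $\phi(\bar X)\in\mathbb R^{n_1\times\cdots\times n_d}$ be the tensor $\phi(\bar X)(i_1,\dots,i_d)=X^1(i_1)X^2(i_2)\cdots X^d(i_d)$, where $X^k(i)\in\mathbb R^{r_{k-1}\times r_k}$ is the $i$-th slice of $X^k$. For $A=(A_1,\dots,A_{d-1})\in\mathcal G=GL(r_1)\times\cdots\times GL(r_{d-1})$ and $\bar Z\in E$ put $$\theta_A(\bar Z)=\{Z^1\times_3A_1^{\mathsf T},\;Z^2\times_1A_1^{-1}\times_3A_2^{\mathsf T},\;\dots,\;Z^d\times_1A_{d-1}^{-1}\}.$$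 Call $\bar X,\bar Y\in\overline{\mathcal M}_r$ equivalent if $\phi(\bar X)=\phi(\bar Y)$, let $[\bar X]$ be the equivalence class of $\bar X$, let $\overline{\mathcal M}_r/\mathcal G$ be the set of equivalence classes with the quotient topology, and $\pi(\bar X)=[\bar X]$. For $\bar X\in\overline{\mathcal M}_r$ and $\bar\xi,\bar\eta\in E$ the preconditioned metric is $$\bar g_{\bar X}(\bar\xi,\bar\eta)=\sum_{k=1}^d\big\langle\phi(X^1,\dots,X^{k-1},\xi^k,X^{k+1},\dots,X^d),\,\phi(X^1,\dots,X^{k-1},\eta^k,X^{k+1},\dots,X^d)\big\rangle .$$ The vertical space $\mathcal V_{\bar X}$ is the tangent space at $\bar X$ to $[\bar X]$ (the velocities at $\bar X$ of smooth curves in $[\bar X]$), and the horizontal space is $\mathcal H_{\bar X}=\{\bar\xi\in E:\bar g_{\bar X}(\bar\xi,\bar\eta)=0\text{ for all }\bar\eta\in\mathcal V_{\bar X}\}$. Then $\bar X,\bar Y\in\overline{\mathcal M}_r$ are equivalent if and only if $\bar Y=\theta_A(\bar X)$ for some $A\in\mathcal G$. The space $\overline{\mathcal M}_r/\mathcal G$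 is Hausdorff and second countable, and it has a smooth manifold structure of dimension $\sum_{k=1}^dr_{k-1}n_kr_k-\sum_{k=1}^{d-1}r_k^2$ for which $\pi$ is a smooth submersion (if $\overline{\mathcal M}_r=\emptyset$, this says nothing). For every such structure the following hold. (1) For every $\bar X\in\overline{\mathcal M}_r$ and every $\xi\in T_{[\bar X]}(\overline{\mathcal M}_r/\mathcal G)$ there is exactly one $\bar\xi_{\bar X}\in\mathcal H_{\bar X}$ with $\mathrm D\pi(\bar X)[\bar\xi_{\bar X}]=\xi$, the horizontal lift of $\xi$ at $\bar X$. (2) If $\bar Y=\theta_A(\bar X)$ with $\bar X,\bar Y\in\overline{\mathcal M}_r$ and $A\in\mathcal G$, then $\bar\xi_{\bar Y}=\theta_A(\bar\xi_{\bar X})$ for every $\xi\in T_{[\bar X]}(\overline{\mathcal M}_r/\mathcal G)$. (3) If $\bar X$ and $\bar Y$ are equivalent, then $\bar g_{\bar X}(\bar\xi_{\bar X},\bar\eta_{\bar X})=\bar g_{\bar Y}(\bar\xi_{\bar Y},\bar\eta_{\bar Y})$ for all $\xi,\eta\in T_{[\bar X]}(\overline{\mathcal M}_r/\mathcal G)$.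 (4) There is exactly one smooth Riemannian metric $g$ on $\overline{\mathcal M}_r/\mathcal G$ such that $g_{[\bar X]}(\xi,\eta)=\bar g_{\bar X}(\bar\xi_{\bar X},\bar\eta_{\bar X})$ for all $\bar X\in\overline{\mathcal M}_r$ and $\xi,\eta\in T_{[\bar X]}(\overline{\mathcal M}_r/\mathcal G)$. -/

import Mathlib

open scoped Manifold ContDiff

noncomputable section

namespace TensorTrain

/-- Third order tensors of size `a × m × b`. -/
abbrev Core (a m b : ℕ) : Type := Fin a → Fin m → Fin b → ℝ

/-- The left unfolding `L(Z)`, a matrix of size `(a m) × b`. -/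
def leftUnfold {a m b : ℕ} (Z : Core a m b) : Matrix (Fin a × Fin m) (Fin b) ℝ :=
  fun p l => Z p.1 p.2 l

/-- The right unfolding `R(Z)`, a matrix of size `a × (m b)`. -/
def rightUnfold {a m b : ℕ} (Z : Core a m b) : Matrix (Fin a) (Fin m × Fin b) ℝ :=
  fun l p => Z l p.1 p.2

/-- The mode-1 product `Z ×₁ A`. -/
def modeOne {a a' m b : ℕ} (Z : Core a m b) (A : Matrix (Fin a') (Fin a) ℝ) : Core a' m b :=
  fun j i l => ∑ s, Z s i l * A j s

/-- The mode-3 product `Z ×₃ A`. -/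
def modeThree {a m b b' : ℕ} (Z : Core a m b) (A : Matrix (Fin b') (Fin b) ℝ) : Core a m b' :=
  fun l i j => ∑ s, Z l i s * A j s

/-- The linear space of tuples of core tensors of sizes `r_{k-1} × n_k × r_k`, `k = 1, …, d`
(with `k` shifted so that it ranges over `Fin d`). -/
abbrev Cores {d : ℕ} (n : Fin d → ℕ) (r : Fin (d + 1) → ℕ) : Type :=
  ∀ k : Fin d, Core (r k.castSucc) (n k) (r k.succ)

/-- Full tensors of size `n_1 × ⋯ × n_d`. -/
abbrev Tensor {d : ℕ} (n : Fin d → ℕ) : Type := (∀ k : Fin d, Fin (n k)) → ℝ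

/-- The Euclidean (Frobenius) inner product of tensors. -/
def frobInner {d : ℕ} {n : Fin d → ℕ} (S T : Tensor n) : ℝ := ∑ i, S i * T i

/-- The map `φ` from tuples of cores to tensors,
`φ(X)(i_1, …, i_d) = ∑ X^1(ℓ_0, i_1, ℓ_1) X^2(ℓ_1, i_2, ℓ_2) ⋯ X^d(ℓ_{d-1}, i_d, ℓ_d)`;
when `r_0 = r_d = 1` the indices `ℓ_0` and `ℓ_d` take a single value. -/
def phi {d : ℕ} {n : Fin d → ℕ} {r : Fin (d + 1) → ℕ} (X : Cores n r) : Tensor n :=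
  fun i => ∑ l : (∀ k : Fin (d + 1), Fin (r k)), ∏ k : Fin d, X k (l k.castSucc) (i k) (l k.succ)

/-- The full rank conditions `rank L(X^k) = r_k`, `rank R(X^k) = r_{k-1}`, for all `k`. -/
def FullRank {d : ℕ} {n : Fin d → ℕ} {r : Fin (d + 1) → ℕ} (X : Cores n r) : Prop :=
  ∀ k : Fin d, (leftUnfold (X k)).rank = r k.succ ∧ (rightUnfold (X k)).rank = r k.castSucc

theorem rank_eq_iff_linearIndependent {m : Type} [Fintype m] {b : ℕ}
    (M : Matrix m (Fin b) ℝ) : M.rank = b ↔ LinearIndependent ℝ (fun j => M.col j) := by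
  rw [linearIndependent_iff_card_eq_finrank_span, Matrix.rank_eq_finrank_span_cols,
    Fintype.card_fin, Set.finrank]
  exact eq_comm

theorem isOpen_fullRank {d : ℕ} (n : Fin d → ℕ) (r : Fin (d + 1) → ℕ) :
    IsOpen {X : Cores n r | FullRank X} := by
  have h : {X : Cores n r | FullRank X} = ⋂ k : Fin d,
      ({X : Cores n r | LinearIndependent ℝ (fun j => (leftUnfold (X k)).col j)} ∩
        {X : Cores n r | LinearIndependent ℝ (fun j => (rightUnfold (X k)).transpose.col j)}) := by
    ext X
    simp only [FullRank, Set.mem_ofPred_eq, Set.mem_iInter, Set.mem_inter_iff,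
      ← rank_eq_iff_linearIndependent, Matrix.rank_transpose]
  rw [h]
  refine isOpen_iInter_of_finite fun k => IsOpen.inter ?_ ?_
  · refine isOpen_setOfPred_linearIndependent.preimage
      (f := fun X : Cores n r => fun j => (leftUnfold (X k)).col j) ?_
    unfold leftUnfold Matrix.col Matrix.transpose
    simp only
    fun_prop
  · refine isOpen_setOfPred_linearIndependent.preimage
      (f := fun X : Cores n r => fun j => (rightUnfold (X k)).transpose.col j) ?_
    unfold rightUnfold Matrix.col Matrix.transpose
    simp only [Matrix.of_apply]
    fun_prop

/-- The total space of tuples of full rank cores, an open subset of `Cores n r`, hence a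
smooth manifold all of whose tangent spaces are `Cores n r`. -/
def totalSpace {d : ℕ} (n : Fin d → ℕ) (r : Fin (d + 1) → ℕ) :
    TopologicalSpace.Opens (Cores n r) :=
  ⟨{X | FullRank X}, isOpen_fullRank n r⟩

/-- The group `GL(r_1) × ⋯ × GL(r_{d-1})`, as the group of tuples `(A_0, …, A_d)` of invertible
matrices with `A_0 = 1` and `A_d = 1`. -/
def gaugeGroup {d : ℕ} (r : Fin (d + 1) → ℕ) :
    Subgroup (∀ k : Fin (d + 1), GL (Fin (r k)) ℝ) where
  carrier := {A | A 0 = 1 ∧ A (Fin.last d) = 1}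
  one_mem' := by simp
  mul_mem' := by
    rintro A B ⟨h0, h1⟩ ⟨h2, h3⟩
    simp [h0, h1, h2, h3]
  inv_mem' := by
    rintro A ⟨h0, h1⟩
    simp [h0, h1]

/-- `θ_A(Z) = {Z^1 ×₃ A_1ᵀ, Z^2 ×₁ A_1⁻¹ ×₃ A_2ᵀ, …, Z^d ×₁ A_{d-1}⁻¹}`, on tuples of cores. -/
def theta {d : ℕ} {n : Fin d → ℕ} {r : Fin (d + 1) → ℕ} (A : gaugeGroup r) (Z : Cores n r) :
    Cores n r :=
  fun k => modeThree
    (modeOne (Z k) ((A.1 k.castSucc)⁻¹ : GL (Fin (r k.castSucc)) ℝ).1)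
    (A.1 k.succ).1.transpose

/-- Two points of the total space are equivalent if they represent the same tensor. -/
def equivSetoid {d : ℕ} (n : Fin d → ℕ) (r : Fin (d + 1) → ℕ) : Setoid (totalSpace n r) :=
  Setoid.ker fun X => phi X.1

/-- The quotient of the total space, the set of equivalence classes with the quotient topology. -/
def QuotientSpace {d : ℕ} (n : Fin d → ℕ) (r : Fin (d + 1) → ℕ) : Type :=
  Quotient (equivSetoid n r)

instance {d : ℕ} (n : Fin d → ℕ) (r : Fin (d + 1) → ℕ) : TopologicalSpace (QuotientSpace n r) :=
  inferInstanceAs (TopologicalSpace (Quotient (equivSetoid n r)))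

/-- The natural projection `π(X) = [X]`. -/
def proj {d : ℕ} {n : Fin d → ℕ} {r : Fin (d + 1) → ℕ} (X : totalSpace n r) :
    QuotientSpace n r :=
  Quotient.mk (equivSetoid n r) X

/-- The equivalence class `[X]`, as a subset of the linear space of tuples of cores. -/
def equivClass {d : ℕ} {n : Fin d → ℕ} {r : Fin (d + 1) → ℕ} (X : totalSpace n r) :
    Set (Cores n r) :=
  {Y | ∃ h : Y ∈ totalSpace n r, proj ⟨Y, h⟩ = proj X}

/-- The vertical space at `X`: the tangent space at `X` to the equivalence class `[X]`, that is,
the set of velocities at `X` of smooth curves in `[X]`. -/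
def verticalSpace {d : ℕ} {n : Fin d → ℕ} {r : Fin (d + 1) → ℕ} (X : totalSpace n r) :
    Set (Cores n r) :=
  {v | ∃ γ : ℝ → Cores n r, ContDiff ℝ ∞ γ ∧ (∀ t, γ t ∈ equivClass X) ∧ γ 0 = X.1 ∧
    deriv γ 0 = v}

/-- The preconditioned metric at `X`,
`∑ k, ⟨φ{X^1, …, ξ^k, …, X^d}, φ{X^1, …, η^k, …, X^d}⟩`. -/
def preMetric {d : ℕ} {n : Fin d → ℕ} {r : Fin (d + 1) → ℕ} (X : totalSpace n r)
    (ξ η : Cores n r) : ℝ :=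
  ∑ k : Fin d, frobInner (phi (Function.update X.1 k (ξ k))) (phi (Function.update X.1 k (η k)))

/-- The horizontal space at `X`: the orthogonal complement of the vertical space with respect to
the preconditioned metric. -/
def horizontalSpace {d : ℕ} {n : Fin d → ℕ} {r : Fin (d + 1) → ℕ} (X : totalSpace n r) :
    Set (Cores n r) :=
  {ξ | ∀ η ∈ verticalSpace X, preMetric X ξ η = 0}

/-- `∑_{k=1}^d r_{k-1} n_k r_k - ∑_{k=1}^{d-1} r_k^2`. (The subtraction of natural numbers
can only be truncated when the total space is empty.) -/
def quotientDim {d : ℕ} (n : Fin d → ℕ) (r : Fin (d + 1) → ℕ) : ℕ :=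
  (∑ k : Fin d, r k.castSucc * n k * r k.succ) -
    ∑ k ∈ Finset.univ.filter (fun k : Fin (d + 1) => k ≠ 0 ∧ k ≠ Fin.last d), r k ^ 2

/-- The Euclidean space on which the quotient is modelled. -/
abbrev QuotientModel {d : ℕ} (n : Fin d → ℕ) (r : Fin (d + 1) → ℕ) : Type :=
  EuclideanSpace ℝ (Fin (quotientDim n r))

/-- A manifold structure on the quotient makes it a quotient manifold of the total space if it is
smooth and the projection `π` is a smooth submersion. -/
structure IsQuotientManifold {d : ℕ} (n : Fin d → ℕ) (r : Fin (d + 1) → ℕ)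
    [ChartedSpace (QuotientModel n r) (QuotientSpace n r)] : Prop where
  isManifold : IsManifold 𝓘(ℝ, QuotientModel n r) ∞ (QuotientSpace n r)
  contMDiff_proj : ContMDiff 𝓘(ℝ, Cores n r) 𝓘(ℝ, QuotientModel n r) ∞
    (proj : totalSpace n r → QuotientSpace n r)
  surjective_mfderiv_proj : ∀ X : totalSpace n r, Function.Surjective
    (mfderiv 𝓘(ℝ, Cores n r) 𝓘(ℝ, QuotientModel n r)
      (proj : totalSpace n r → QuotientSpace n r) X)

/-- `ξbar` is a horizontal lift at `X` of the tangent vector `ξ` of the quotient at the point `q`: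
it is horizontal and `Dπ(X)[ξbar] = ξ`. The equation is one in the tangent bundle of the
quotient, so that it contains `π(X) = q`. -/
def IsHorizontalLift {d : ℕ} {n : Fin d → ℕ} {r : Fin (d + 1) → ℕ}
    [ChartedSpace (QuotientModel n r) (QuotientSpace n r)]
    (q : QuotientSpace n r) (ξ : TangentSpace 𝓘(ℝ, QuotientModel n r) q)
    (X : totalSpace n r) (ξbar : Cores n r) : Prop :=
  ξbar ∈ horizontalSpace X ∧
    tangentMap 𝓘(ℝ, Cores n r) 𝓘(ℝ, QuotientModel n r)
      (proj : totalSpace n r → QuotientSpace n r) ⟨X, ξbar⟩ = ⟨q, ξ⟩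

end TensorTrain

end

noncomputable section

namespace TensorTrain

open Matrix

/-! Cutting the chain of cores at position `k` factors the `k`-th unfolding of `phi X` as `leftMat X
k * rightMat X k`. Full rank of all core unfoldings, together with `r 0 = r (Fin.last d) = 1`, makes
the left factor injective and the right factor of full row rank (`left_injective`,
`right_injective`). Two such factorizations of one tensor differ by an invertible matrix at each
cut, and these matrices form the gauge transformation (`exists_theta_of_phi_eq`). Hence classes are
orbits, `proj` is open, and `phi` descends to a continuous injection, which gives the Hausdorff
property.

Charts come from an explicit normal form. Fix left inverses `P k` of the left factors at a base
point. The pivot `P k * leftMat X k` is multiplied by `A k` on the right under a gauge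
transformation `A`, so undoing the pivot yields a smooth gauge-invariant map (`exists_normalForm`).
Its derivative at the base point is the identity modulo the infinitesimal orbit directions and kills
those directions. Composing it with a linear map whose kernel is this space gives a coordinate of
the classes with a smooth section (`exists_local_slice`), from which `exists_quotient_manifold`
builds an atlas. The dimension is right because the infinitesimal action is injective.

For an arbitrary structure making `proj` a submersion, exponential curves and a dimension count
identify the vertical space with the kernel of the derivative of `proj` (`mem_verticalSpace_iff`).
The preconditioned metric is positive definite and gauge invariant (`metricCLM_pos`,
`metricCLM_theta`), so lifts, their equivariance and the invariance of the metric become linear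
algebra. The induced metric is the inverse of `L G⁻¹ Lᵀ` (`quotForm`), which depends smoothly on `G`
and `L`; evaluating it along local sections proves smoothness downstairs. -/

/-- The `i`-th slice of a core. -/
def slice {a m b : ℕ} (Z : Core a m b) (i : Fin m) : Matrix (Fin a) (Fin b) ℝ :=
  fun l l' => Z l i l'

theorem core_ext_slice {a m b : ℕ} {Z Z' : Core a m b} (h : ∀ i, slice Z i = slice Z' i) :
    Z = Z' := by
  funext l i l'
  exact congrFun (congrFun (h i) l) l'

/-! ### Partial products of a chain of matrices -/

section Chain

variable {d : ℕ} {r : Fin (d + 1) → ℕ}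

/-- The product of the first `k` matrices of a chain, multiplied from the left by a row of ones. -/
def leftProd (M : ∀ k : Fin d, Matrix (Fin (r k.castSucc)) (Fin (r k.succ)) ℝ) :
    ∀ k : Fin (d + 1), Fin (r k) → ℝ :=
  Fin.induction (fun _ => 1) (fun k v => v ᵥ* M k)

/-- The product of the matrices of a chain from position `k` on, multiplied from the right by a
column of ones. -/
def rightProd (M : ∀ k : Fin d, Matrix (Fin (r k.castSucc)) (Fin (r k.succ)) ℝ) :
    ∀ k : Fin (d + 1), Fin (r k) → ℝ :=
  Fin.reverseInduction (fun _ => 1) (fun k v => M k *ᵥ v)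

variable (M M' : ∀ k : Fin d, Matrix (Fin (r k.castSucc)) (Fin (r k.succ)) ℝ)

@[simp] theorem leftProd_zero : leftProd M 0 = fun _ => 1 := rfl

@[simp] theorem leftProd_succ (k : Fin d) :
    leftProd M k.succ = leftProd M k.castSucc ᵥ* M k := by
  simp [leftProd]

@[simp] theorem rightProd_last : rightProd M (Fin.last d) = fun _ => 1 := by
  simp [rightProd]

@[simp] theorem rightProd_castSucc (k : Fin d) :
    rightProd M k.castSucc = M k *ᵥ rightProd M k.succ := by
  simp [rightProd]

theorem leftProd_congr {k : Fin (d + 1)} (h : ∀ j : Fin d, j.castSucc < k → M j = M' j) :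
    leftProd M k = leftProd M' k := by
  induction k using Fin.induction with
  | zero => rfl
  | succ k ih =>
    rw [leftProd_succ, leftProd_succ, h k Fin.castSucc_lt_succ,
      ih fun j hj => h j (hj.trans Fin.castSucc_lt_succ)]

theorem rightProd_congr {k : Fin (d + 1)} (h : ∀ j : Fin d, k ≤ j.castSucc → M j = M' j) :
    rightProd M k = rightProd M' k := by
  induction k using Fin.reverseInduction with
  | last => simp
  | cast k ih =>
    rw [rightProd_castSucc, rightProd_castSucc, h k le_rfl,
      ih fun j hj => h j (Fin.castSucc_lt_succ.le.trans hj)]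

/-- Moving one matrix across the dot product changes the cut by one position, so the pairing does
not depend on the cut. -/
theorem leftProd_dotProduct_rightProd (k : Fin (d + 1)) :
    leftProd M k ⬝ᵥ rightProd M k = ∑ l, rightProd M 0 l := by
  induction k using Fin.induction with
  | zero => simp [dotProduct]
  | succ k ih =>
    rw [← ih, leftProd_succ, rightProd_castSucc, dotProduct_mulVec]

end Chain

theorem rightProd_tail {d : ℕ} {r : Fin (d + 2) → ℕ}
    (M : ∀ k : Fin (d + 1), Matrix (Fin (r k.castSucc)) (Fin (r k.succ)) ℝ) (k : Fin (d + 1)) :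
    rightProd (r := fun j => r j.succ) (fun j : Fin d => M j.succ) k = rightProd M k.succ := by
  induction k using Fin.reverseInduction with
  | last =>
    rw [rightProd_last]
    exact (rightProd_last M).symm
  | cast k ih =>
    rw [rightProd_castSucc, ih]
    exact (rightProd_castSucc M k.succ).symm

/-- The weight `f` makes the induction close: fixing the first index at `a` leaves a shorter chain
weighted by the row `M 0 a`. -/
theorem sum_prod_chain {d : ℕ} {r : Fin (d + 1) → ℕ}
    (M : ∀ k : Fin d, Matrix (Fin (r k.castSucc)) (Fin (r k.succ)) ℝ) (f : Fin (r 0) → ℝ) :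
    ∑ l : (∀ k : Fin (d + 1), Fin (r k)), f (l 0) * ∏ k : Fin d, M k (l k.castSucc) (l k.succ) =
      ∑ l, f l * rightProd M 0 l := by
  induction d with
  | zero =>
    have : rightProd M 0 = fun _ => 1 := rightProd_last M
    simp only [Finset.univ_eq_empty, Finset.prod_empty, this, mul_one]
    exact Fintype.sum_equiv (Equiv.piUnique (fun k : Fin 1 => Fin (r k))) _ _ fun _ => rfl
  | succ d ih =>
    rw [← (Fin.consEquiv fun k => Fin (r k)).sum_comp, Fintype.sum_prod_type]
    refine Finset.sum_congr rfl fun a _ => ?_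
    have := ih (r := fun j => r j.succ) (fun j => M j.succ) (fun l => M 0 a l)
    simp only [Fin.consEquiv_apply, Fin.cons_zero, Fin.prod_univ_succ, ← Finset.mul_sum] at this ⊢
    congr 1
    rw [show rightProd M 0 = M 0 *ᵥ rightProd M (Fin.succ 0) from rightProd_castSucc M 0,
      ← rightProd_tail M 0]
    exact this

/-! ### Left and right interfaces of a tuple of cores, and full rank -/

section Interface

variable {d : ℕ} {n : Fin d → ℕ} {r : Fin (d + 1) → ℕ}

/-- The row vector `X^1(i_1) ⋯ X^k(i_k)`. -/
def left (X : Cores n r) (k : Fin (d + 1)) (i : ∀ k : Fin d, Fin (n k)) : Fin (r k) → ℝ :=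
  leftProd (fun j => slice (X j) (i j)) k

/-- The column vector `X^{k+1}(i_{k+1}) ⋯ X^d(i_d)`. -/
def right (X : Cores n r) (k : Fin (d + 1)) (i : ∀ k : Fin d, Fin (n k)) : Fin (r k) → ℝ :=
  rightProd (fun j => slice (X j) (i j)) k

@[simp] theorem left_zero (X : Cores n r) (i) : left X 0 i = fun _ => 1 := rfl

@[simp] theorem left_succ (X : Cores n r) (k : Fin d) (i) :
    left X k.succ i = left X k.castSucc i ᵥ* slice (X k) (i k) := leftProd_succ _ k

@[simp] theorem right_last (X : Cores n r) (i) : right X (Fin.last d) i = fun _ => 1 :=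
  rightProd_last _

@[simp] theorem right_castSucc (X : Cores n r) (k : Fin d) (i) :
    right X k.castSucc i = slice (X k) (i k) *ᵥ right X k.succ i := rightProd_castSucc _ k

theorem left_congr {X X' : Cores n r} {k : Fin (d + 1)} {i i' : ∀ k : Fin d, Fin (n k)}
    (hX : ∀ j : Fin d, j.castSucc < k → X j = X' j)
    (hi : ∀ j : Fin d, j.castSucc < k → i j = i' j) :
    left X k i = left X' k i' :=
  leftProd_congr _ _ fun j hj => by rw [hX j hj, hi j hj]

theorem right_congr {X X' : Cores n r} {k : Fin (d + 1)} {i i' : ∀ k : Fin d, Fin (n k)}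
    (hX : ∀ j : Fin d, k ≤ j.castSucc → X j = X' j)
    (hi : ∀ j : Fin d, k ≤ j.castSucc → i j = i' j) :
    right X k i = right X' k i' :=
  rightProd_congr _ _ fun j hj => by rw [hX j hj, hi j hj]

theorem phi_eq_dotProduct (X : Cores n r) (k : Fin (d + 1)) (i) :
    phi X i = left X k i ⬝ᵥ right X k i := by
  rw [left, right, leftProd_dotProduct_rightProd]
  simpa [phi, slice, right] using sum_prod_chain (fun j => slice (X j) (i j)) (fun _ => 1)

/-- The multi-index that agrees with `i` before position `k` and with `i'` from position `k` on. -/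
def mix (k : Fin (d + 1)) (i i' : ∀ k : Fin d, Fin (n k)) : ∀ k : Fin d, Fin (n k) :=
  fun j => if j.castSucc < k then i j else i' j

theorem left_mix (X : Cores n r) (k : Fin (d + 1)) (i i') : left X k (mix k i i') = left X k i :=
  left_congr (fun _ _ => rfl) fun j hj => by simp [mix, hj]

theorem right_mix (X : Cores n r) (k : Fin (d + 1)) (i i') :
    right X k (mix k i i') = right X k i' :=
  right_congr (fun _ _ => rfl) fun j hj => by simp [mix, not_lt.2 hj]

/-- Mixing lets the row and column indices of the `k`-th unfolding vary independently while both are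
recorded as complete multi-indices. -/
theorem phi_mix (X : Cores n r) (k : Fin (d + 1)) (i i') :
    phi X (mix k i i') = left X k i ⬝ᵥ right X k i' := by
  rw [phi_eq_dotProduct X k, left_mix, right_mix]

theorem left_update (X : Cores n r) (k : Fin d) (ζ) (i) :
    left (Function.update X k ζ) k.castSucc i = left X k.castSucc i :=
  left_congr (fun j hj => Function.update_of_ne (by rintro rfl; exact lt_irrefl _ hj) _ _)
    fun _ _ => rfl

theorem right_update (X : Cores n r) (k : Fin d) (ζ) (i) :
    right (Function.update X k ζ) k.succ i = right X k.succ i :=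
  right_congr (fun j hj => Function.update_of_ne
    (by rintro rfl; exact absurd hj (not_le.2 Fin.castSucc_lt_succ)) _ _) fun _ _ => rfl

theorem left_update_index (X : Cores n r) (k : Fin d) (i) (m) :
    left X k.castSucc (Function.update i k m) = left X k.castSucc i :=
  left_congr (fun _ _ => rfl)
    fun j hj => Function.update_of_ne (by rintro rfl; exact lt_irrefl _ hj) _ _

theorem right_update_index (X : Cores n r) (k : Fin d) (i) (m) :
    right X k.succ (Function.update i k m) = right X k.succ i :=
  right_congr (fun _ _ => rfl) fun j hj => Function.update_of_ne
    (by rintro rfl; exact absurd hj (not_le.2 Fin.castSucc_lt_succ)) _ _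

theorem phi_update (X : Cores n r) (k : Fin d) (ζ) (i) :
    phi (Function.update X k ζ) i =
      left X k.castSucc i ⬝ᵥ (slice ζ (i k) *ᵥ right X k.succ i) := by
  rw [phi_eq_dotProduct _ k.castSucc, right_castSucc, left_update, right_update,
    Function.update_self]

theorem rank_leftUnfold_iff {a m b : ℕ} (Z : Core a m b) :
    (leftUnfold Z).rank = b ↔ ∀ v : Fin b → ℝ, (∀ i, slice Z i *ᵥ v = 0) → v = 0 := by
  rw [rank_eq_iff_linearIndependent]
  change LinearIndependent ℝ (leftUnfold Z).col ↔ _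
  rw [← Matrix.mulVec_injective_iff, ← Matrix.coe_mulVecLin, ← LinearMap.ker_eq_bot,
    LinearMap.ker_eq_bot']
  refine forall_congr' fun v => imp_congr ?_ Iff.rfl
  constructor
  · intro h i
    funext l
    exact congrFun h (l, i)
  · intro h
    funext p
    exact congrFun (h p.2) p.1

theorem rank_rightUnfold_iff {a m b : ℕ} (Z : Core a m b) :
    (rightUnfold Z).rank = a ↔ ∀ v : Fin a → ℝ, (∀ i, v ᵥ* slice Z i = 0) → v = 0 := by
  rw [← Matrix.rank_transpose, rank_eq_iff_linearIndependent]
  change LinearIndependent ℝ (rightUnfold Z)ᵀ.col ↔ _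
  rw [← Matrix.mulVec_injective_iff, ← Matrix.coe_mulVecLin, ← LinearMap.ker_eq_bot,
    LinearMap.ker_eq_bot']
  refine forall_congr' fun v => imp_congr ?_ Iff.rfl
  rw [Matrix.mulVecLin_apply, Matrix.mulVec_transpose]
  constructor
  · intro h i
    funext l
    exact congrFun h (i, l)
  · intro h
    funext p
    exact congrFun (h p.1) p.2

theorem fullRank_iff {X : Cores n r} : FullRank X ↔
    ∀ k : Fin d, (∀ v, (∀ i, slice (X k) i *ᵥ v = 0) → v = 0) ∧
      (∀ v, (∀ i, v ᵥ* slice (X k) i = 0) → v = 0) := by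
  simp only [FullRank, rank_leftUnfold_iff, rank_rightUnfold_iff]

/-- Backward induction: if a core had no rows but some column, its slices would kill the vector of
ones, against the rank of the left unfolding. -/
theorem r_pos {X : Cores n r} (hX : FullRank X) (h1 : r (Fin.last d) = 1) (k : Fin (d + 1)) :
    0 < r k := by
  induction k using Fin.reverseInduction with
  | last => simp [h1]
  | cast k ih =>
    rcases Nat.eq_zero_or_pos (r k.castSucc) with h0 | h0
    · have := ((fullRank_iff.1 hX) k).1 1 fun i => by
        funext l
        exact (Fin.cast h0 l).elim0
      exact absurd (congrFun this ⟨0, ih⟩) one_ne_zero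
    · exact h0

/-- Guarantees that a multi-index exists, without which the base cases of the two injectivity lemmas
below would fail. -/
theorem n_pos {X : Cores n r} (hX : FullRank X) (h1 : r (Fin.last d) = 1) (k : Fin d) :
    0 < n k := by
  rcases Nat.eq_zero_or_pos (n k) with h0 | h0
  · have := ((fullRank_iff.1 hX) k).1 1 fun i => (Fin.cast h0 i).elim0
    exact absurd (congrFun this ⟨0, r_pos hX h1 _⟩) one_ne_zero
  · exact h0

/-- Varying the index at `k` alone replaces `v` by `slice (X k) m *ᵥ v` at the previous cut. The
induction hypothesis kills all these vectors, and the left unfolding then forces `v = 0`. -/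
theorem left_injective {X : Cores n r} (hX : FullRank X) (h0 : r 0 = 1)
    (h1 : r (Fin.last d) = 1) (k : Fin (d + 1)) (v : Fin (r k) → ℝ)
    (hv : ∀ i, left X k i ⬝ᵥ v = 0) : v = 0 := by
  induction k using Fin.induction with
  | zero =>
    have := hv fun k => ⟨0, n_pos hX h1 k⟩
    have : Subsingleton (Fin (r 0)) := by rw [h0]; infer_instance
    funext l
    simpa [dotProduct, Fintype.sum_subsingleton _ l] using hv fun k => ⟨0, n_pos hX h1 k⟩
  | succ k ih =>
    refine ((fullRank_iff.1 hX) k).1 v fun m => ih _ fun i => ?_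
    have := hv (Function.update i k m)
    rwa [left_succ, ← dotProduct_mulVec, left_update_index, Function.update_self] at this

theorem right_injective {X : Cores n r} (hX : FullRank X)
    (h1 : r (Fin.last d) = 1) (k : Fin (d + 1)) (v : Fin (r k) → ℝ)
    (hv : ∀ i, v ⬝ᵥ right X k i = 0) : v = 0 := by
  induction k using Fin.reverseInduction with
  | last =>
    have : Subsingleton (Fin (r (Fin.last d))) := by rw [h1]; infer_instance
    funext l
    simpa [dotProduct, Fintype.sum_subsingleton _ l] using hv fun k => ⟨0, n_pos hX h1 k⟩
  | cast k ih =>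
    refine ((fullRank_iff.1 hX) k).2 v fun m => ih _ fun i => ?_
    have := hv (Function.update i k m)
    rwa [right_castSucc, dotProduct_mulVec, right_update_index, Function.update_self] at this

end Interface

theorem exists_leftInverse_of_mulVec {I : Type*} [Fintype I] [DecidableEq I] {b : ℕ}
    (M : Matrix I (Fin b) ℝ) (h : ∀ v, M *ᵥ v = 0 → v = 0) :
    ∃ P : Matrix (Fin b) I ℝ, P * M = 1 := by
  obtain ⟨g, hg⟩ := M.mulVecLin.exists_leftInverse_of_injective (LinearMap.ker_eq_bot'.2 h)
  refine ⟨LinearMap.toMatrix' g, ?_⟩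
  rw [← LinearMap.toMatrix'_toLin' M, ← LinearMap.toMatrix'_comp, Matrix.toLin'_apply', hg,
    LinearMap.toMatrix'_id]

theorem mul_left_cancel_of_mulVec {I : Type*} {b c : ℕ}
    (M : Matrix I (Fin b) ℝ) (h : ∀ v, M *ᵥ v = 0 → v = 0) {S T : Matrix (Fin b) (Fin c) ℝ}
    (hST : M * S = M * T) : S = T := by
  rw [← sub_eq_zero]
  refine Matrix.ext_col fun j => ?_
  refine h _ ?_
  have : M * (S - T) = 0 := by rw [Matrix.mul_sub, hST, sub_self]
  funext i
  exact congrFun (congrFun this i) j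

/-! ### The gauge action; equivalence classes are its orbits -/

section Gauge

variable {d : ℕ} {n : Fin d → ℕ} {r : Fin (d + 1) → ℕ}

/-- Families of square matrices of sizes `r_0, …, r_d`. -/
abbrev GaugeAlg (r : Fin (d + 1) → ℕ) : Type := ∀ k : Fin (d + 1), Matrix (Fin (r k)) (Fin (r k)) ℝ

/-- The tuple of cores with slices `A'_{k-1} Z^k(i) A_k`. -/
def act (A' A : GaugeAlg r) (Z : Cores n r) : Cores n r :=
  fun k l i l' => (A' k.castSucc * slice (Z k) i * A k.succ) l l'

@[simp] theorem slice_act (A' A : GaugeAlg r) (Z : Cores n r) (k : Fin d) (i : Fin (n k)) :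
    slice (act A' A Z k) i = A' k.castSucc * slice (Z k) i * A k.succ := rfl

theorem cores_ext_slice {Z Z' : Cores n r} (h : ∀ k i, slice (Z k) i = slice (Z' k) i) : Z = Z' :=
  funext fun k => core_ext_slice (h k)

@[simp] theorem slice_add {a m b : ℕ} (Z Z' : Core a m b) (i) :
    slice (Z + Z') i = slice Z i + slice Z' i := rfl

@[simp] theorem slice_smul {a m b : ℕ} (c : ℝ) (Z : Core a m b) (i) :
    slice (c • Z) i = c • slice Z i := rfl

theorem theta_eq_act (A : gaugeGroup r) (Z : Cores n r) :
    theta A Z = act (fun k => ((A.1 k)⁻¹ : GL (Fin (r k)) ℝ).1) (fun k => (A.1 k).1) Z := by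
  funext k l i l'
  simp only [theta, act, modeThree, modeOne, Matrix.mul_apply, transpose_apply, slice]
  refine Finset.sum_congr rfl fun s _ => ?_
  congr 1
  exact Finset.sum_congr rfl fun s _ => mul_comm _ _

@[simp] theorem slice_theta (A : gaugeGroup r) (Z : Cores n r) (k : Fin d) (i : Fin (n k)) :
    slice (theta A Z k) i = ((A.1 k.castSucc)⁻¹ : GL (Fin (r k.castSucc)) ℝ).1 * slice (Z k) i *
      (A.1 k.succ).1 := by
  rw [theta_eq_act, slice_act]

theorem act_act (A' A B' B : GaugeAlg r) (Z : Cores n r) :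
    act A' A (act B' B Z) = act (A' * B') (B * A) Z :=
  cores_ext_slice fun k i => by simp [Matrix.mul_assoc]

@[simp] theorem act_one (Z : Cores n r) : act 1 1 Z = Z :=
  cores_ext_slice fun k i => by simp

/-- The action of a gauge transformation as a linear map. -/
def thetaLin (A : gaugeGroup r) : Cores n r →ₗ[ℝ] Cores n r where
  toFun := theta A
  map_add' Z Z' := cores_ext_slice fun k i => by simp [Matrix.mul_add, Matrix.add_mul]
  map_smul' c Z := cores_ext_slice fun k i => by simp

theorem theta_mul (A B : gaugeGroup r) (Z : Cores n r) :
    theta (A * B) Z = theta B (theta A Z) :=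
  cores_ext_slice fun k i => by simp [Matrix.mul_assoc]

@[simp] theorem theta_one (Z : Cores n r) : theta 1 Z = Z :=
  cores_ext_slice fun k i => by simp

@[simp] theorem theta_theta_inv (A : gaugeGroup r) (Z : Cores n r) :
    theta A (theta A⁻¹ Z) = Z := by
  rw [← theta_mul, inv_mul_cancel, theta_one]

/-- The gauge transformation given by a family of matrices and their inverses. -/
def gaugeMk (A A' : GaugeAlg r) (h : A * A' = 1) (h0 : A 0 = 1) (h1 : A (Fin.last d) = 1) :
    gaugeGroup r :=
  ⟨fun k => ⟨A k, A' k, congrFun h k, mul_eq_one_comm.1 (congrFun h k)⟩,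
    Units.ext h0, Units.ext h1⟩

theorem theta_gaugeMk (A A' : GaugeAlg r) (h : A * A' = 1) (h0 : A 0 = 1)
    (h1 : A (Fin.last d) = 1) (Z : Cores n r) : theta (gaugeMk A A' h h0 h1) Z = act A' A Z :=
  theta_eq_act _ _

/-- Between consecutive cores `A k` meets its inverse, so only the last factor survives; at the
start `A 0 = 1`. -/
theorem left_theta (A : gaugeGroup r) (Z : Cores n r) (k : Fin (d + 1)) (i) :
    left (theta A Z) k i = left Z k i ᵥ* (A.1 k).1 := by
  induction k using Fin.induction with
  | zero => simp [A.2.1]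
  | succ k ih =>
    rw [left_succ, left_succ, ih, slice_theta, vecMul_vecMul, vecMul_vecMul, Matrix.mul_assoc,
      ← Matrix.mul_assoc (A.1 k.castSucc).1]
    simp

theorem phi_theta (A : gaugeGroup r) (Z : Cores n r) : phi (theta A Z) = phi Z := by
  funext i
  rw [phi_eq_dotProduct _ (Fin.last d), phi_eq_dotProduct _ (Fin.last d), left_theta, A.2.2]
  simp

theorem fullRank_theta (A : gaugeGroup r) {X : Cores n r} (hX : FullRank X) :
    FullRank (theta A X) := by
  rw [fullRank_iff] at hX ⊢
  refine fun k => ⟨fun v hv => ?_, fun v hv => ?_⟩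
  · have h : (A.1 k.succ).1 *ᵥ v = 0 := (hX k).1 _ fun i => by
      have := congrArg ((A.1 k.castSucc).1 *ᵥ ·) (hv i)
      simpa [← Matrix.mul_assoc] using this
    simpa using congrArg (((A.1 k.succ)⁻¹ : GL (Fin (r k.succ)) ℝ).1 *ᵥ ·) h
  · have h : v ᵥ* ((A.1 k.castSucc)⁻¹ : GL (Fin (r k.castSucc)) ℝ).1 = 0 := (hX k).2 _ fun i => by
      have := congrArg (· ᵥ* ((A.1 k.succ)⁻¹ : GL (Fin (r k.succ)) ℝ).1) (hv i)
      simpa [Matrix.mul_assoc] using this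
    simpa using congrArg (· ᵥ* (A.1 k.castSucc).1) h

/-- The action treats each core separately. With `phi_theta`, this gives the invariance of every
summand of the preconditioned metric. -/
theorem update_theta (A : gaugeGroup r) (X ξ : Cores n r) (k : Fin d) :
    Function.update (theta A X) k (theta A ξ k) = theta A (Function.update X k (ξ k)) := by
  funext j
  rcases eq_or_ne j k with rfl | h
  · simp [theta]
  · simp [theta, h]

/-- The matrix with rows `X^1(i_1) ⋯ X^k(i_k)`. -/
def leftMat (X : Cores n r) (k : Fin (d + 1)) : Matrix (∀ k : Fin d, Fin (n k)) (Fin (r k)) ℝ :=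
  fun i => left X k i

/-- The matrix with columns `X^{k+1}(i_{k+1}) ⋯ X^d(i_d)`. -/
def rightMat (X : Cores n r) (k : Fin (d + 1)) : Matrix (Fin (r k)) (∀ k : Fin d, Fin (n k)) ℝ :=
  fun l i => right X k i l

theorem leftMat_mul_rightMat (X : Cores n r) (k : Fin (d + 1)) :
    leftMat X k * rightMat X k = fun i i' => phi X (mix k i i') := by
  funext i i'
  rw [phi_mix]
  rfl

theorem leftMat_theta (A : gaugeGroup r) (Z : Cores n r) (k : Fin (d + 1)) :
    leftMat (theta A Z) k = leftMat Z k * (A.1 k).1 :=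
  funext fun i => left_theta A Z k i

theorem leftMat_mulVec {X : Cores n r} (hX : FullRank X) (h0 : r 0 = 1)
    (h1 : r (Fin.last d) = 1) (k : Fin (d + 1)) (v) (hv : leftMat X k *ᵥ v = 0) : v = 0 :=
  left_injective hX h0 h1 k v fun i => congrFun hv i

theorem rightMat_vecMul {X : Cores n r} (hX : FullRank X)
    (h1 : r (Fin.last d) = 1) (k : Fin (d + 1)) (v) (hv : v ᵥ* rightMat X k = 0) : v = 0 :=
  right_injective hX h1 k v fun i => congrFun hv i

/-- Both products of left and right factors are the same unfolding; multiplying by a right inverse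
of `rightMat Y k` isolates `leftMat Y k`. -/
theorem exists_leftMat_eq_mul {X Y : Cores n r} (hY : FullRank Y)
    (h1 : r (Fin.last d) = 1) (h : phi X = phi Y) (k : Fin (d + 1)) :
    ∃ A : Matrix (Fin (r k)) (Fin (r k)) ℝ, leftMat Y k = leftMat X k * A := by
  obtain ⟨P, hP⟩ := exists_leftInverse_of_mulVec (rightMat Y k)ᵀ fun v hv =>
    rightMat_vecMul hY h1 k v (by rwa [mulVec_transpose] at hv)
  have hP' : rightMat Y k * Pᵀ = 1 := by
    rw [← transpose_transpose (rightMat Y k), ← transpose_mul, hP, transpose_one]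
  refine ⟨rightMat X k * Pᵀ, ?_⟩
  rw [← Matrix.mul_assoc, leftMat_mul_rightMat, h, ← leftMat_mul_rightMat, Matrix.mul_assoc, hP',
    Matrix.mul_one]

theorem exists_theta_of_phi_eq {X Y : Cores n r} (hX : FullRank X) (hY : FullRank Y)
    (h0 : r 0 = 1) (h1 : r (Fin.last d) = 1) (h : phi X = phi Y) :
    ∃ A : gaugeGroup r, Y = theta A X := by
  choose A hA using exists_leftMat_eq_mul hY h1 h
  choose B hB using exists_leftMat_eq_mul hX h1 h.symm
  have hcX : ∀ k {S T : Matrix (Fin (r k)) (Fin (r k)) ℝ},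
      leftMat X k * S = leftMat X k * T → S = T :=
    fun k {_ _} => mul_left_cancel_of_mulVec _ (leftMat_mulVec hX h0 h1 k)
  have hAB : A * B = 1 := funext fun k => hcX k <| by
    rw [Pi.mul_apply, ← Matrix.mul_assoc, ← hA, ← hB, Pi.one_apply, Matrix.mul_one]
  have hA0 : A 0 = 1 := hcX 0 <| by
    rw [← hA, Matrix.mul_one]
    rfl
  -- The boundary condition at the right end: both right factors there consist of ones, so `A
  -- (Fin.last d) - 1` annihilates a matrix of full row rank.
  have hR : rightMat X (Fin.last d) = A (Fin.last d) * rightMat Y (Fin.last d) := by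
    have : leftMat X (Fin.last d) * rightMat X (Fin.last d) =
        leftMat X (Fin.last d) * (A (Fin.last d) * rightMat Y (Fin.last d)) := by
      rw [← Matrix.mul_assoc, ← hA, leftMat_mul_rightMat, leftMat_mul_rightMat, h]
    obtain ⟨P, hP⟩ := exists_leftInverse_of_mulVec _ (leftMat_mulVec hX h0 h1 (Fin.last d))
    have := congrArg (P * ·) this
    simpa only [← Matrix.mul_assoc, hP, Matrix.one_mul] using this
  have hA1 : A (Fin.last d) = 1 := by
    have hXY : rightMat X (Fin.last d) = rightMat Y (Fin.last d) := by
      funext l i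
      simp [rightMat]
    have h2 : (A (Fin.last d) - 1) * rightMat Y (Fin.last d) = 0 := by
      rw [Matrix.sub_mul, ← hR, hXY, Matrix.one_mul, sub_self]
    rw [← sub_eq_zero]
    funext l
    exact rightMat_vecMul hY h1 _ _ (congrFun h2 l)
  refine ⟨gaugeMk A B hAB hA0 hA1, cores_ext_slice fun k m => ?_⟩
  rw [theta_gaugeMk, slice_act]
  -- Setting the index at `k` to `m` in the relation at `k.succ` appends the slice `m` to the left
  -- product; the injective `leftMat X k.castSucc` then cancels.
  have key : A k.castSucc * slice (Y k) m = slice (X k) m * A k.succ := by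
    refine mul_left_cancel_of_mulVec _ (leftMat_mulVec hX h0 h1 k.castSucc) ?_
    funext i
    have e := congrFun (hA k.succ) (Function.update i k m)
    have e1 : leftMat Y k.succ (Function.update i k m) =
        leftMat Y k.castSucc i ᵥ* slice (Y k) m := by
      simp [leftMat, left_update_index]
    have e2 : (leftMat X k.succ * A k.succ) (Function.update i k m) =
        (leftMat X k.castSucc i ᵥ* slice (X k) m) ᵥ* A k.succ := by
      change leftMat X k.succ (Function.update i k m) ᵥ* A k.succ = _
      simp [leftMat, left_update_index]
    rw [e1, e2, hA] at e
    rw [← Matrix.mul_assoc, ← Matrix.mul_assoc]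
    rw [vecMul_vecMul] at e
    change (leftMat X k.castSucc * A k.castSucc) i ᵥ* slice (Y k) m =
      leftMat X k.castSucc i ᵥ* slice (X k) m ᵥ* A k.succ
    rw [e, vecMul_vecMul]
  rw [Matrix.mul_assoc, ← key, ← Matrix.mul_assoc, mul_eq_one_comm.1 (congrFun hAB k.castSucc)]
  simp

end Gauge

/-! ### Positivity, invariance and smoothness of the preconditioned metric -/

section Metric

variable {d : ℕ} {n : Fin d → ℕ} {r : Fin (d + 1) → ℕ}

theorem phi_update_add (X : Cores n r) (k : Fin d) (ζ ζ') :
    phi (Function.update X k (ζ + ζ')) =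
      phi (Function.update X k ζ) + phi (Function.update X k ζ') := by
  funext i
  simp [phi_update, add_mulVec, dotProduct_add]

theorem phi_update_smul (X : Cores n r) (k : Fin d) (c : ℝ) (ζ) :
    phi (Function.update X k (c • ζ)) = c • phi (Function.update X k ζ) := by
  funext i
  simp [phi_update, smul_mulVec, dotProduct_smul]

/-- The replaced core sits between a left and a right interface, neither of which involves it;
injectivity on the two sides strips them off in turn. -/
theorem eq_zero_of_phi_update_eq_zero {X : Cores n r} (hX : FullRank X) (h0 : r 0 = 1)
    (h1 : r (Fin.last d) = 1) (k : Fin d) {ζ} (h : phi (Function.update X k ζ) = 0) : ζ = 0 := by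
  refine core_ext_slice fun m => ?_
  have key : ∀ i', slice ζ m *ᵥ right X k.succ i' = 0 := fun i' =>
    left_injective hX h0 h1 k.castSucc _ fun i => by
      -- This multi-index is `i` before `k`, `m` at `k` and `i'` after, so the three parts vary
      -- independently.
      have e := congrFun h (mix k.castSucc i (Function.update i' k m))
      rw [phi_update, left_mix] at e
      have e1 : mix k.castSucc i (Function.update i' k m) k = m := by simp [mix]
      have e2 : right X k.succ (mix k.castSucc i (Function.update i' k m)) = right X k.succ i' := by
        refine right_congr (fun _ _ => rfl) fun j hj => ?_
        have hj' : k.castSucc < j.castSucc := Fin.castSucc_lt_succ.trans_le hj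
        have hjk : j ≠ k := by
          rintro rfl
          exact lt_irrefl _ hj'
        simp only [mix, not_lt.2 hj'.le, if_false]
        exact Function.update_of_ne hjk _ _
      rwa [e1, e2] at e
  funext l
  exact right_injective hX h1 k.succ _ fun i => congrFun (key i) l

/-- The preconditioned metric as a bilinear form, at an arbitrary tuple of cores. -/
def metricForm (X : Cores n r) : Cores n r →ₗ[ℝ] Cores n r →ₗ[ℝ] ℝ :=
  LinearMap.mk₂ ℝ
    (fun ξ η => ∑ k : Fin d,
      frobInner (phi (Function.update X k (ξ k))) (phi (Function.update X k (η k))))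
    (fun ξ ξ' η => by
      simp [phi_update_add, frobInner, add_mul, Finset.sum_add_distrib])
    (fun c ξ η => by
      simp [phi_update_smul, frobInner, Finset.mul_sum, mul_assoc])
    (fun ξ η η' => by
      simp [phi_update_add, frobInner, mul_add, Finset.sum_add_distrib])
    (fun c ξ η => by
      simp [phi_update_smul, frobInner, Finset.mul_sum, mul_left_comm])

/-- The preconditioned metric as a continuous bilinear form. -/
def metricCLM (X : Cores n r) : Cores n r →L[ℝ] Cores n r →L[ℝ] ℝ :=
  (metricForm X).toContinuousBilinearMap

theorem metricCLM_apply (X ξ η : Cores n r) : metricCLM X ξ η = ∑ k : Fin d,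
    frobInner (phi (Function.update X k (ξ k))) (phi (Function.update X k (η k))) := rfl

theorem preMetric_eq (X : totalSpace n r) (ξ η : Cores n r) :
    preMetric X ξ η = metricCLM X.1 ξ η := rfl

theorem frobInner_comm (S T : Tensor n) : frobInner S T = frobInner T S :=
  Finset.sum_congr rfl fun _ _ => mul_comm _ _

theorem metricCLM_symm (X ξ η : Cores n r) : metricCLM X ξ η = metricCLM X η ξ := by
  rw [metricCLM_apply, metricCLM_apply]
  exact Finset.sum_congr rfl fun _ _ => frobInner_comm _ _

theorem frobInner_self_nonneg (S : Tensor n) : 0 ≤ frobInner S S :=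
  Finset.sum_nonneg fun _ _ => mul_self_nonneg _

theorem metricCLM_pos {X : Cores n r} (hX : FullRank X) (h0 : r 0 = 1)
    (h1 : r (Fin.last d) = 1) {ξ : Cores n r} (hξ : ξ ≠ 0) : 0 < metricCLM X ξ ξ := by
  rw [metricCLM_apply]
  refine lt_of_le_of_ne (Finset.sum_nonneg fun _ _ => frobInner_self_nonneg _) fun h => hξ ?_
  funext k
  refine eq_zero_of_phi_update_eq_zero hX h0 h1 k ?_
  have h2 := (Finset.sum_eq_zero_iff_of_nonneg fun _ _ => frobInner_self_nonneg _).1 h.symm k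
    (Finset.mem_univ k)
  funext i
  exact mul_self_eq_zero.1 ((Finset.sum_eq_zero_iff_of_nonneg fun _ _ => mul_self_nonneg _).1 h2 i
    (Finset.mem_univ i))

theorem metricCLM_theta (A : gaugeGroup r) (X ξ η : Cores n r) :
    metricCLM (theta A X) (theta A ξ) (theta A η) = metricCLM X ξ η := by
  simp only [metricCLM_apply, update_theta, phi_theta]

theorem contDiff_entry (k : Fin d) (l i l') :
    ContDiff ℝ ∞ fun X : Cores n r => X k l i l' :=
  contDiff_pi.1 (contDiff_pi.1 (contDiff_pi.1 (contDiff_pi.1 contDiff_id k) l) i) l'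

theorem contDiff_phi : ContDiff ℝ ∞ (phi : Cores n r → Tensor n) := by
  rw [contDiff_pi]
  intro i
  exact ContDiff.sum fun l _ => contDiff_prod fun k _ => contDiff_entry _ _ _ _

theorem contDiff_update (k : Fin d) (ζ) :
    ContDiff ℝ ∞ fun X : Cores n r => Function.update X k ζ := by
  rw [contDiff_pi]
  intro j
  rcases eq_or_ne j k with rfl | h
  · simpa using contDiff_const
  · simpa [h] using contDiff_pi.1 (contDiff_id (𝕜 := ℝ) (E := Cores n r)) j

theorem contDiff_metricCLM : ContDiff ℝ ∞ (metricCLM : Cores n r → _) := by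
  rw [contDiff_clm_apply_iff]
  intro ξ
  rw [contDiff_clm_apply_iff]
  intro η
  simp only [metricCLM_apply, frobInner]
  have h := fun k (ζ : Core (r k.castSucc) (n k) (r k.succ)) =>
    contDiff_pi.1 (contDiff_phi.comp (contDiff_update (n := n) (r := r) k ζ))
  exact ContDiff.sum fun k _ => ContDiff.sum fun i _ => (h k _ i).mul (h k _ i)

end Metric

/-! ### The infinitesimal action and the dimension count -/

section Lie

variable {d : ℕ} {n : Fin d → ℕ} {r : Fin (d + 1) → ℕ}

/-- The infinitesimal action, with slices `X^k(i) B_k - B_{k-1} X^k(i)`. -/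
def infAct (X : Cores n r) (B : GaugeAlg r) : Cores n r :=
  fun k l i l' => (slice (X k) i * B k.succ - B k.castSucc * slice (X k) i) l l'

@[simp] theorem slice_infAct (X : Cores n r) (B : GaugeAlg r) (k : Fin d) (i : Fin (n k)) :
    slice (infAct X B k) i = slice (X k) i * B k.succ - B k.castSucc * slice (X k) i := rfl

/-- The Lie algebra of the gauge group. -/
def gaugeLie (r : Fin (d + 1) → ℕ) : Submodule ℝ (GaugeAlg r) where
  carrier := {B | B 0 = 0 ∧ B (Fin.last d) = 0}
  add_mem' := by
    rintro A B ⟨h0, h1⟩ ⟨h2, h3⟩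
    simp [h0, h1, h2, h3]
  zero_mem' := by simp
  smul_mem' := by
    rintro c A ⟨h0, h1⟩
    simp [h0, h1]

/-- Elements of the Lie algebra are given by their components in the middle positions. -/
def gaugeLieEquiv (r : Fin (d + 1) → ℕ) : gaugeLie r ≃ₗ[ℝ]
    ∀ k : {k : Fin (d + 1) // k ≠ 0 ∧ k ≠ Fin.last d}, Matrix (Fin (r k)) (Fin (r k)) ℝ where
  toFun B k := B.1 k
  invFun B := ⟨fun k => if h : k ≠ 0 ∧ k ≠ Fin.last d then B ⟨k, h⟩ else 0, by simp, by simp⟩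
  left_inv B := by
    ext1
    funext k
    by_cases h0 : k = 0
    · subst h0
      simp [B.2.1]
    · by_cases h1 : k = Fin.last d
      · subst h1
        simp [B.2.2]
      · simp [h0, h1]
  right_inv B := by
    funext k
    simp [k.2.1, k.2.2]
  map_add' _ _ := rfl
  map_smul' _ _ := rfl

theorem finrank_gaugeLie (r : Fin (d + 1) → ℕ) : Module.finrank ℝ (gaugeLie r) =
    ∑ k ∈ Finset.univ.filter (fun k : Fin (d + 1) => k ≠ 0 ∧ k ≠ Fin.last d), r k ^ 2 := by
  rw [(gaugeLieEquiv r).finrank_eq, Module.finrank_pi_fintype]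
  simp only [Module.finrank_matrix, Fintype.card_fin, Module.finrank_self, mul_one]
  rw [Finset.sum_subtype (F := inferInstance)
    (p := fun k : Fin (d + 1) => k ≠ 0 ∧ k ≠ Fin.last d) _ (by simp)]
  simp [sq]

theorem finrank_cores (n : Fin d → ℕ) (r : Fin (d + 1) → ℕ) :
    Module.finrank ℝ (Cores n r) = ∑ k : Fin d, r k.castSucc * n k * r k.succ := by
  rw [Module.finrank_pi_fintype]
  refine Finset.sum_congr rfl fun k _ => ?_
  rw [Module.finrank_pi_fintype]
  simp [Module.finrank_pi_fintype, mul_assoc]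

/-- The infinitesimal action of the Lie algebra as a linear map. -/
def infActLin (X : Cores n r) : gaugeLie r →ₗ[ℝ] Cores n r where
  toFun B := infAct X B.1
  map_add' B B' := cores_ext_slice fun k i => by
    simp [Matrix.mul_add, Matrix.add_mul]
    abel
  map_smul' c B := cores_ext_slice fun k i => by simp [smul_sub]

/-- Starting from `B 0 = 0`, once the component to the left of a core vanishes, every slice of that
core kills the component to its right, and the left unfolding has full column rank. -/
theorem infActLin_injective {X : Cores n r} (hX : FullRank X) :
    Function.Injective (infActLin X) := by
  rw [← LinearMap.ker_eq_bot, LinearMap.ker_eq_bot']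
  intro B hB
  ext1
  funext k
  change B.1 k = 0
  induction k using Fin.induction with
  | zero => exact B.2.1
  | succ k ih =>
    refine Matrix.ext_col fun j => ((fullRank_iff.1 hX) k).1 _ fun i => ?_
    have h : slice (infAct X B.1 k) i = 0 := congrArg (fun Z : Cores n r => slice (Z k) i) hB
    rw [slice_infAct, ih, Matrix.zero_mul, sub_zero] at h
    funext l
    exact congrFun (congrFun h l) j

/-- Stated additively: the injective action embeds the Lie algebra in the cores, so the subtraction
in `quotientDim` is not truncated once a full rank tuple exists. -/
theorem finrank_range_infActLin {X : Cores n r} (hX : FullRank X) :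
    Module.finrank ℝ (LinearMap.range (infActLin X)) + quotientDim n r =
      Module.finrank ℝ (Cores n r) := by
  have h1 := LinearMap.finrank_range_of_inj (infActLin_injective hX)
  have h2 := (LinearMap.range (infActLin X)).finrank_le
  rw [h1] at h2 ⊢
  rw [finrank_gaugeLie, finrank_cores] at h2 ⊢
  exact Nat.add_sub_cancel' h2

end Lie

end TensorTrain

/-! ### Exponentials and inversion in finite-dimensional algebras -/

section BanachAlgebra

variable {𝔸 : Type*} [NormedRing 𝔸] [NormedAlgebra ℝ 𝔸] [FiniteDimensional ℝ 𝔸]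
  {E : Type*} [NormedAddCommGroup E] [NormedSpace ℝ E]

/-- Smoothness of algebra-valued maps is tested on linear forms, so that the results for matrix
families can be stated without a norm on them; a norm enters only where Banach algebra calculus is
used. -/
theorem contDiff_of_forall_linear {F : Type*} [NormedAddCommGroup F] [NormedSpace ℝ F]
    [FiniteDimensional ℝ F] {f : E → F} (h : ∀ ℓ : F →ₗ[ℝ] ℝ, ContDiff ℝ ∞ fun x => ℓ (f x)) :
    ContDiff ℝ ∞ f := by
  let b := Module.finBasis ℝ F
  rw [show f = fun x => ∑ i, b.coord i (f x) • b i from funext fun x => (b.sum_repr (f x)).symm]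
  exact ContDiff.sum fun i _ => (h (b.coord i)).smul contDiff_const

theorem hasDerivAt_of_forall_linear {F : Type*} [NormedAddCommGroup F] [NormedSpace ℝ F]
    [FiniteDimensional ℝ F] {f : ℝ → F} {v : F} {t : ℝ}
    (h : ∀ ℓ : F →ₗ[ℝ] ℝ, HasDerivAt (fun x => ℓ (f x)) (ℓ v) t) : HasDerivAt f v t := by
  let b := Module.finBasis ℝ F
  rw [show f = fun x => ∑ i, b.coord i (f x) • b i from funext fun x => (b.sum_repr (f x)).symm,
    show v = ∑ i, b.coord i v • b i from (b.sum_repr v).symm]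
  exact HasDerivAt.fun_sum fun i _ => (h (b.coord i)).smul_const (b i)

theorem exists_exp_curve (B : 𝔸) : ∃ A A' : ℝ → 𝔸,
    (∀ ℓ : 𝔸 →ₗ[ℝ] ℝ, ContDiff ℝ ∞ (fun t => ℓ (A t)) ∧ ContDiff ℝ ∞ (fun t => ℓ (A' t)) ∧
      HasDerivAt (fun t => ℓ (A t)) (ℓ B) 0 ∧ HasDerivAt (fun t => ℓ (A' t)) (ℓ (-B)) 0) ∧
    (∀ t, A t * A' t = 1) ∧ A 0 = 1 ∧ A' 0 = 1 ∧ (B = 0 → ∀ t, A t = 1) := by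
  have : CompleteSpace 𝔸 := FiniteDimensional.complete ℝ 𝔸
  let : NormedAlgebra ℚ 𝔸 := NormedAlgebra.restrictScalars ℚ ℝ 𝔸
  have hexp : ContDiff ℝ ∞ (NormedSpace.exp : 𝔸 → 𝔸) :=
    AnalyticOnNhd.contDiff fun x _ => NormedSpace.exp_analytic (𝕂 := ℝ) x
  have hE : ∀ C : 𝔸, ContDiff ℝ ∞ fun t : ℝ => NormedSpace.exp (t • C) := fun C =>
    hexp.comp (contDiff_id.smul contDiff_const)
  have hd : ∀ C : 𝔸, HasDerivAt (fun t : ℝ => NormedSpace.exp (t • C)) C 0 := fun C => by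
    simpa using hasDerivAt_exp_smul_const (𝕂 := ℝ) C 0
  -- The clause for `B = 0` is what later keeps the end components of a gauge curve equal to the
  -- identity.
  refine ⟨fun t => NormedSpace.exp (t • B), fun t => NormedSpace.exp (t • (-B)), fun ℓ =>
    ⟨?_, ?_, ?_, ?_⟩, fun t => ?_, by simp, by simp, ?_⟩
  · exact (LinearMap.toContinuousLinearMap ℓ).contDiff.comp (hE B)
  · exact (LinearMap.toContinuousLinearMap ℓ).contDiff.comp (hE (-B))
  · exact (LinearMap.toContinuousLinearMap ℓ).hasFDerivAt.comp_hasDerivAt 0 (hd B)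
  · exact (LinearMap.toContinuousLinearMap ℓ).hasFDerivAt.comp_hasDerivAt 0 (hd (-B))
  · beta_reduce
    rw [smul_neg, ← NormedSpace.exp_add_of_commute (Commute.refl _).neg_right, add_neg_cancel,
      NormedSpace.exp_zero]
  · rintro rfl t
    simp

theorem isOpen_isUnit_comp {f : E → 𝔸} (hf : ∀ ℓ : 𝔸 →ₗ[ℝ] ℝ, ContDiff ℝ ∞ fun x => ℓ (f x)) :
    IsOpen {x | IsUnit (f x)} := by
  have : CompleteSpace 𝔸 := FiniteDimensional.complete ℝ 𝔸
  exact Units.isOpen.preimage (contDiff_of_forall_linear hf).continuous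

theorem contDiffAt_ringInverse_comp {f : E → 𝔸}
    (hf : ∀ ℓ : 𝔸 →ₗ[ℝ] ℝ, ContDiff ℝ ∞ fun x => ℓ (f x)) {x : E} (hx : IsUnit (f x))
    (ℓ : 𝔸 →ₗ[ℝ] ℝ) : ContDiffAt ℝ ∞ (fun x => ℓ (Ring.inverse (f x))) x := by
  have : CompleteSpace 𝔸 := FiniteDimensional.complete ℝ 𝔸
  obtain ⟨u, hu⟩ := hx
  have h : ContDiffAt ℝ ∞ Ring.inverse (f x) := by
    rw [← hu]
    exact contDiffAt_ringInverse ℝ u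
  exact (LinearMap.toContinuousLinearMap ℓ).contDiff.contDiffAt.comp x
    (h.comp x (contDiff_of_forall_linear hf).contDiffAt)

theorem hasDerivAt_ringInverse_comp {f : ℝ → 𝔸} {B : 𝔸} {t : ℝ}
    (hf : ∀ ℓ : 𝔸 →ₗ[ℝ] ℝ, HasDerivAt (fun t => ℓ (f t)) (ℓ B) t) (ht : f t = 1)
    (ℓ : 𝔸 →ₗ[ℝ] ℝ) : HasDerivAt (fun t => ℓ (Ring.inverse (f t))) (ℓ (-B)) t := by
  have : CompleteSpace 𝔸 := FiniteDimensional.complete ℝ 𝔸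
  have h : HasFDerivAt Ring.inverse (-ContinuousLinearMap.mulLeftRight ℝ 𝔸 1 1) (f t) := by
    rw [ht]
    simpa using hasFDerivAt_ringInverse (𝕜 := ℝ) (1 : 𝔸ˣ)
  have h2 := h.comp_hasDerivAt t (hasDerivAt_of_forall_linear hf)
  have h3 := (LinearMap.toContinuousLinearMap ℓ).hasFDerivAt.comp_hasDerivAt t h2
  simpa using! h3

end BanachAlgebra

namespace TensorTrain

open Matrix

/-! ### Gauge curves and a smooth local normal form -/

section NormalForm

variable {d : ℕ} {n : Fin d → ℕ} {r : Fin (d + 1) → ℕ}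

/-- The entries of a family of matrices, as linear forms. -/
def entryLin (k : Fin (d + 1)) (l l' : Fin (r k)) : GaugeAlg r →ₗ[ℝ] ℝ where
  toFun A := A k l l'
  map_add' _ _ := rfl
  map_smul' _ _ := rfl

theorem gaugeAlg_eq_sum (A : GaugeAlg r) :
    A = ∑ k, ∑ l, ∑ l', A k l l' • (Pi.single k (Matrix.single l l' 1) : GaugeAlg r) := by
  funext k l l'
  simp only [Finset.sum_apply, Pi.smul_apply, Matrix.sum_apply, Matrix.smul_apply, smul_eq_mul]
  rw [Finset.sum_eq_single k, Finset.sum_eq_single l, Finset.sum_eq_single l']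
  · simp
  · intro j _ hj
    simp [hj]
  · simp
  · intro j _ hj
    simp [hj]
  · simp
  · intro j _ hj
    simp [hj.symm]
  · simp

theorem linear_apply_eq_sum (ℓ : GaugeAlg r →ₗ[ℝ] ℝ) (A : GaugeAlg r) :
    ℓ A = ∑ k, ∑ l, ∑ l', A k l l' * ℓ (Pi.single k (Matrix.single l l' 1)) := by
  conv_lhs => rw [gaugeAlg_eq_sum A]
  simp only [map_sum, map_smul, smul_eq_mul]

theorem contDiff_linear_comp {E : Type*} [NormedAddCommGroup E] [NormedSpace ℝ E]
    {f : E → GaugeAlg r} (h : ∀ k l l', ContDiff ℝ ∞ fun x => f x k l l')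
    (ℓ : GaugeAlg r →ₗ[ℝ] ℝ) : ContDiff ℝ ∞ fun x => ℓ (f x) := by
  rw [funext fun x => linear_apply_eq_sum ℓ (f x)]
  exact ContDiff.sum fun k _ => ContDiff.sum fun l _ => ContDiff.sum fun l' _ =>
    (h k l l').mul contDiff_const

theorem hasDerivAt_linear_comp {f : ℝ → GaugeAlg r} {B : GaugeAlg r} {t : ℝ}
    (h : ∀ k l l', HasDerivAt (fun x => f x k l l') (B k l l') t)
    (ℓ : GaugeAlg r →ₗ[ℝ] ℝ) : HasDerivAt (fun x => ℓ (f x)) (ℓ B) t := by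
  rw [linear_apply_eq_sum ℓ B, funext fun x => linear_apply_eq_sum ℓ (f x)]
  exact HasDerivAt.fun_sum fun k _ => HasDerivAt.fun_sum fun l _ => HasDerivAt.fun_sum fun l' _ =>
    (h k l l').mul_const _

section Norm

open scoped Matrix.Norms.Operator

/-- The exponential is taken in each factor separately, so a vanishing component of `B` gives a
constant component of the curve. -/
theorem gaugeAlg_exists_exp_curve (B : GaugeAlg r) : ∃ A A' : ℝ → GaugeAlg r,
    (∀ ℓ : GaugeAlg r →ₗ[ℝ] ℝ,
      ContDiff ℝ ∞ (fun t => ℓ (A t)) ∧ ContDiff ℝ ∞ (fun t => ℓ (A' t)) ∧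
      HasDerivAt (fun t => ℓ (A t)) (ℓ B) 0 ∧ HasDerivAt (fun t => ℓ (A' t)) (ℓ (-B)) 0) ∧
    (∀ t, A t * A' t = 1) ∧ A 0 = 1 ∧ A' 0 = 1 ∧ (∀ k, B k = 0 → ∀ t, A t k = 1) := by
  choose A A' h1 h2 h3 h4 h5 using fun k => exists_exp_curve (B k)
  refine ⟨fun t k => A k t, fun t k => A' k t, fun ℓ => ⟨?_, ?_, ?_, ?_⟩,
    fun t => funext fun k => h2 k t, funext h3, funext h4, h5⟩
  · exact contDiff_linear_comp (fun k l l' => (h1 k (Matrix.entryLinearMap ℝ ℝ l l')).1) ℓ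
  · exact contDiff_linear_comp (fun k l l' => (h1 k (Matrix.entryLinearMap ℝ ℝ l l')).2.1) ℓ
  · exact hasDerivAt_linear_comp (fun k l l' => (h1 k (Matrix.entryLinearMap ℝ ℝ l l')).2.2.1) ℓ
  · exact hasDerivAt_linear_comp (fun k l l' => (h1 k (Matrix.entryLinearMap ℝ ℝ l l')).2.2.2) ℓ

theorem gaugeAlg_isOpen_isUnit {E : Type*} [NormedAddCommGroup E] [NormedSpace ℝ E]
    {f : E → GaugeAlg r} (h : ∀ ℓ : GaugeAlg r →ₗ[ℝ] ℝ, ContDiff ℝ ∞ fun x => ℓ (f x)) :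
    IsOpen {x | IsUnit (f x)} :=
  isOpen_isUnit_comp (𝔸 := GaugeAlg r) h

theorem gaugeAlg_contDiffAt_ringInverse {E : Type*} [NormedAddCommGroup E] [NormedSpace ℝ E]
    {f : E → GaugeAlg r} (h : ∀ ℓ : GaugeAlg r →ₗ[ℝ] ℝ, ContDiff ℝ ∞ fun x => ℓ (f x)) {x : E}
    (hx : IsUnit (f x)) (ℓ : GaugeAlg r →ₗ[ℝ] ℝ) :
    ContDiffAt ℝ ∞ (fun x => ℓ (Ring.inverse (f x))) x :=
  contDiffAt_ringInverse_comp (𝔸 := GaugeAlg r) h hx ℓ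

theorem gaugeAlg_hasDerivAt_ringInverse {f : ℝ → GaugeAlg r} {B : GaugeAlg r} {t : ℝ}
    (hf : ∀ ℓ : GaugeAlg r →ₗ[ℝ] ℝ, HasDerivAt (fun t => ℓ (f t)) (ℓ B) t) (ht : f t = 1)
    (ℓ : GaugeAlg r →ₗ[ℝ] ℝ) : HasDerivAt (fun t => ℓ (Ring.inverse (f t))) (ℓ (-B)) t :=
  hasDerivAt_ringInverse_comp (𝔸 := GaugeAlg r) hf ht ℓ

end Norm

theorem act_apply (A' A : GaugeAlg r) (Z : Cores n r) (k : Fin d) (l i l') :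
    act A' A Z k l i l' =
      ∑ s', (∑ s, A' k.castSucc l s * Z k s i s') * A k.succ s' l' := rfl

theorem contDiffAt_act {E : Type*} [NormedAddCommGroup E] [NormedSpace ℝ E]
    {A' A : E → GaugeAlg r} {Z : E → Cores n r} {x : E}
    (hA' : ∀ ℓ : GaugeAlg r →ₗ[ℝ] ℝ, ContDiffAt ℝ ∞ (fun x => ℓ (A' x)) x)
    (hA : ∀ ℓ : GaugeAlg r →ₗ[ℝ] ℝ, ContDiffAt ℝ ∞ (fun x => ℓ (A x)) x)
    (hZ : ContDiffAt ℝ ∞ Z x) : ContDiffAt ℝ ∞ (fun x => act (A' x) (A x) (Z x)) x := by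
  refine contDiffAt_pi.2 fun k => contDiffAt_pi.2 fun l => contDiffAt_pi.2 fun i => contDiffAt_pi.2
    fun l' => ?_
  simp only [act_apply]
  exact ContDiffAt.sum fun s' _ => ContDiffAt.mul (ContDiffAt.sum fun s _ =>
    ContDiffAt.mul (hA' (entryLin k.castSucc l s))
    ((contDiff_entry k s i s').contDiffAt.comp x hZ)) (hA (entryLin k.succ s' l'))

/-- The product rule for `A' Z A` at the identity: the outer factors contribute `-B X + X B`, the
infinitesimal action. -/
theorem hasDerivAt_act {A' A : ℝ → GaugeAlg r} {Z : ℝ → Cores n r} {B : GaugeAlg r}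
    {X ξ : Cores n r} (hA' : ∀ ℓ : GaugeAlg r →ₗ[ℝ] ℝ, HasDerivAt (fun t => ℓ (A' t)) (ℓ (-B)) 0)
    (hA : ∀ ℓ : GaugeAlg r →ₗ[ℝ] ℝ, HasDerivAt (fun t => ℓ (A t)) (ℓ B) 0)
    (hZ : HasDerivAt Z ξ 0) (hA'0 : A' 0 = 1) (hA0 : A 0 = 1) (hZ0 : Z 0 = X) :
    HasDerivAt (fun t => act (A' t) (A t) (Z t)) (ξ + infAct X B) 0 := by
  refine hasDerivAt_pi.2 fun k => hasDerivAt_pi.2 fun l => hasDerivAt_pi.2 fun i =>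
    hasDerivAt_pi.2 fun l' => ?_
  have e1 : ∀ k l l', HasDerivAt (fun t => A' t k l l') ((-B) k l l') 0 := fun k l l' =>
    hA' (entryLin k l l')
  have e2 : ∀ k l l', HasDerivAt (fun t => A t k l l') (B k l l') 0 := fun k l l' =>
    hA (entryLin k l l')
  have e3 : ∀ k l i l', HasDerivAt (fun t => Z t k l i l') (ξ k l i l') 0 := fun k l i l' =>
    hasDerivAt_pi.1 (hasDerivAt_pi.1 (hasDerivAt_pi.1 (hasDerivAt_pi.1 hZ k) l) i) l'
  have key := HasDerivAt.fun_sum (u := Finset.univ) fun s' _ =>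
    (HasDerivAt.fun_sum (u := Finset.univ) fun s _ =>
      (e1 k.castSucc l s).fun_mul (e3 k s i s')).fun_mul (e2 k.succ s' l')
  simp only [act_apply]
  convert! key using 1
  rw [hA'0, hA0, hZ0]
  have : (ξ + infAct X B) k l i l' = (((-B) k.castSucc * slice (X k) i +
      (1 : GaugeAlg r) k.castSucc * slice (ξ k) i) * (1 : GaugeAlg r) k.succ +
      ((1 : GaugeAlg r) k.castSucc * slice (X k) i) * B k.succ) l l' := by
    change (slice (ξ k) i + slice (infAct X B k) i) l l' = _
    rw [slice_infAct]
    simp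
    abel
  rw [this, Matrix.add_apply, Matrix.mul_apply, Matrix.mul_apply, ← Finset.sum_add_distrib]
  refine Finset.sum_congr rfl fun s' _ => ?_
  simp only [Matrix.add_apply, Matrix.mul_apply, Finset.sum_add_distrib, slice]

theorem exists_gauge_curve (X : Cores n r) (B : gaugeLie r) :
    ∃ γ : ℝ → Cores n r, ContDiff ℝ ∞ γ ∧ (∀ t, ∃ A : gaugeGroup r, γ t = theta A X) ∧
      γ 0 = X ∧ HasDerivAt γ (infActLin X B) 0 := by
  obtain ⟨A, A', h1, h2, h3, h4, h5⟩ := gaugeAlg_exists_exp_curve B.1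
  refine ⟨fun t => act (A' t) (A t) X, ?_, fun t => ?_, by simp [h3, h4], ?_⟩
  · exact contDiff_iff_contDiffAt.2 fun t => contDiffAt_act (fun ℓ => (h1 ℓ).2.1.contDiffAt)
      (fun ℓ => (h1 ℓ).1.contDiffAt) contDiffAt_const
  · exact ⟨gaugeMk _ _ (h2 t) (h5 _ B.2.1 t) (h5 _ B.2.2 t), (theta_gaugeMk _ _ _ _ _ _).symm⟩
  · have := hasDerivAt_act (Z := fun _ => X) (ξ := 0) (X := X) (fun ℓ => (h1 ℓ).2.2.2)
      (fun ℓ => (h1 ℓ).2.2.1) (hasDerivAt_const 0 X) h4 h3 rfl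
    rw [zero_add] at this
    exact this

theorem contDiff_left (k : Fin (d + 1)) (i) (l : Fin (r k)) :
    ContDiff ℝ ∞ fun X : Cores n r => left X k i l := by
  induction k using Fin.induction with
  | zero => exact contDiff_const
  | succ k ih =>
    simp only [left_succ, Matrix.vecMul, dotProduct]
    exact ContDiff.sum fun s _ => (ih s).mul (contDiff_entry _ _ _ _)

/-- The matrices `P_k X^{≤ k}`, where `P_k` are fixed matrices, except at the last position. -/
def pivot (P : ∀ k : Fin (d + 1), Matrix (Fin (r k)) (∀ k : Fin d, Fin (n k)) ℝ)
    (X : Cores n r) : GaugeAlg r :=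
  fun k => if k = Fin.last d then 1 else P k * leftMat X k

theorem contDiff_pivot (P : ∀ k : Fin (d + 1), Matrix (Fin (r k)) (∀ k : Fin d, Fin (n k)) ℝ)
    (ℓ : GaugeAlg r →ₗ[ℝ] ℝ) : ContDiff ℝ ∞ fun X => ℓ (pivot P X) := by
  refine contDiff_linear_comp (fun k l l' => ?_) ℓ
  by_cases h : k = Fin.last d
  · simp only [pivot, h, if_true]
    exact contDiff_const
  · simp only [pivot, h, if_false, Matrix.mul_apply]
    exact ContDiff.sum fun i _ => contDiff_const.mul (contDiff_left k i l')

theorem pivot_theta (P : ∀ k : Fin (d + 1), Matrix (Fin (r k)) (∀ k : Fin d, Fin (n k)) ℝ)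
    (A : gaugeGroup r) (X : Cores n r) :
    pivot P (theta A X) = pivot P X * fun k => (A.1 k).1 := by
  funext k
  by_cases h : k = Fin.last d
  · subst h
    simp [pivot, A.2.2]
  · simp [pivot, h, leftMat_theta, Matrix.mul_assoc]

/-- The left product at position `0` is empty. Hence the pivot there is constant, which supplies the
boundary condition of the gauge group at the left end. -/
theorem pivot_zero (P : ∀ k : Fin (d + 1), Matrix (Fin (r k)) (∀ k : Fin d, Fin (n k)) ℝ)
    (X Y : Cores n r) : pivot P X 0 = pivot P Y 0 := by
  by_cases h : (0 : Fin (d + 1)) = Fin.last d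
  · simp [pivot, h]
  · simp only [pivot, h, if_false]
    rfl

/-- The gauge transform of `X` for which the pivot matrices are the identity. -/
def normalForm (P : ∀ k : Fin (d + 1), Matrix (Fin (r k)) (∀ k : Fin d, Fin (n k)) ℝ)
    (X : Cores n r) : Cores n r :=
  act (pivot P X) (Ring.inverse (pivot P X)) X

theorem normalForm_theta (P : ∀ k : Fin (d + 1), Matrix (Fin (r k)) (∀ k : Fin d, Fin (n k)) ℝ)
    (A : gaugeGroup r) (X : Cores n r) :
    normalForm P (theta A X) = normalForm P X := by
  have hA : (fun k => (A.1 k).1) * (fun k => ((A.1 k)⁻¹ : GL (Fin (r k)) ℝ).1) =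
      (1 : GaugeAlg r) := funext fun k => (A.1 k).mul_inv
  have hA' : (fun k => ((A.1 k)⁻¹ : GL (Fin (r k)) ℝ).1) * (fun k => (A.1 k).1) =
      (1 : GaugeAlg r) := funext fun k => (A.1 k).inv_mul
  set u : (GaugeAlg r)ˣ := ⟨_, _, hA, hA'⟩
  have hinv : Ring.inverse (pivot P (theta A X)) = ((u⁻¹ : (GaugeAlg r)ˣ) : GaugeAlg r) *
      Ring.inverse (pivot P X) := by
    rw [pivot_theta]
    change Ring.inverse (pivot P X * (u : GaugeAlg r)) = _
    by_cases hu : IsUnit (pivot P X)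
    · obtain ⟨v, hv⟩ := hu
      rw [← hv, ← Units.val_mul, Ring.inverse_unit, Ring.inverse_unit, _root_.mul_inv_rev,
        Units.val_mul]
    -- Invariance persists where the pivot is singular: `Ring.inverse` is `0` on non-units, and
    -- multiplication by the unit `u` preserves being a non-unit.
    · rw [Ring.inverse_non_unit _ hu, mul_zero, Ring.inverse_non_unit]
      rwa [Units.isUnit_mul_units]
  rw [normalForm, hinv, pivot_theta, theta_eq_act, act_act, mul_assoc, hA, mul_one, ← mul_assoc]
  change act _ ((u : GaugeAlg r) * ((u⁻¹ : (GaugeAlg r)ˣ) : GaugeAlg r) * _) X = _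
  rw [Units.mul_inv, one_mul, normalForm]

/-- Near a full rank tuple there is a smooth normal form for the action of the gauge group. -/
theorem exists_normalForm {X₀ : Cores n r} (hX₀ : FullRank X₀) (h0 : r 0 = 1)
    (h1 : r (Fin.last d) = 1) :
    ∃ (N : Set (Cores n r)) (ν : Cores n r → Cores n r), IsOpen N ∧ X₀ ∈ N ∧
      (∀ X ∈ N, FullRank X) ∧ ContDiffOn ℝ ∞ ν N ∧ ν X₀ = X₀ ∧
      (∀ X ∈ N, ∃ A : gaugeGroup r, ν X = theta A X) ∧
      (∀ (A : gaugeGroup r) (X), ν (theta A X) = ν X) ∧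
      (∀ ξ, fderiv ℝ ν X₀ ξ - ξ ∈ LinearMap.range (infActLin X₀)) ∧
      (∀ ξ ∈ LinearMap.range (infActLin X₀), fderiv ℝ ν X₀ ξ = 0) := by
  -- These left inverses normalize the pivot to `1` at `X₀`, so that `X₀` is its own normal form and
  -- the pivot stays invertible nearby.
  choose P hP using fun k => exists_leftInverse_of_mulVec _ (leftMat_mulVec hX₀ h0 h1 k)
  have hP0 : pivot P X₀ = 1 := by
    funext k
    by_cases h : k = Fin.last d <;> simp [pivot, h, hP]
  have hP00 : ∀ X, pivot P X 0 = 1 := fun X => by rw [pivot_zero P X X₀, hP0, Pi.one_apply]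
  have hPl : ∀ X, pivot P X (Fin.last d) = 1 := fun X => by simp [pivot]
  have hinvA : ∀ {X}, IsUnit (pivot P X) → ∃ A : gaugeGroup r, normalForm P X = theta A X := by
    intro X hX
    have e := Ring.inverse_mul_cancel _ hX
    have e0 : ∀ k, pivot P X k = 1 → Ring.inverse (pivot P X) k = 1 := fun k hk => by
      have := congrFun e k
      rwa [Pi.mul_apply, hk, mul_one] at this
    exact ⟨gaugeMk _ _ e (e0 _ (hP00 X)) (e0 _ (hPl X)), (theta_gaugeMk _ _ _ _ _ _).symm⟩
  have hν : ∀ X, IsUnit (pivot P X) → ContDiffAt ℝ ∞ (normalForm P) X := by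
    intro X hX
    exact contDiffAt_act (fun ℓ => (contDiff_pivot P ℓ).contDiffAt)
      (gaugeAlg_contDiffAt_ringInverse (contDiff_pivot P) hX) contDiffAt_id
  have hdiff : DifferentiableAt ℝ (normalForm P) X₀ :=
    (hν X₀ (by rw [hP0]; exact isUnit_one)).differentiableAt (by simp)
  have hν0 : normalForm P X₀ = X₀ := by
    rw [normalForm, hP0, Ring.inverse_one, act_one]
  refine ⟨{X | FullRank X} ∩ pivot P ⁻¹' {A | IsUnit A}, normalForm P,
    (isOpen_fullRank n r).inter (gaugeAlg_isOpen_isUnit (contDiff_pivot P)),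
    ⟨hX₀, by simp [hP0]⟩, fun X hX => hX.1, fun X hX => (hν X hX.2).contDiffWithinAt, hν0,
    fun X hX => hinvA hX.2, normalForm_theta P, fun ξ => ?_, ?_⟩
  · have hl : HasDerivAt (fun t : ℝ => X₀ + t • ξ) ξ 0 := by
      simpa using ((hasDerivAt_id (0 : ℝ)).smul_const ξ).const_add X₀
    have hl0 : X₀ + (0 : ℝ) • ξ = X₀ := by simp
    have hcomp : ∀ ℓ : GaugeAlg r →ₗ[ℝ] ℝ, HasDerivAt (fun t : ℝ => ℓ (pivot P (X₀ + t • ξ)))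
        (fderiv ℝ (fun X => ℓ (pivot P X)) X₀ ξ) 0 := fun ℓ => by
      have h := ((contDiff_pivot P ℓ).differentiable (by simp) X₀).hasFDerivAt
      rw [← hl0] at h
      simpa only [hl0] using! h.comp_hasDerivAt 0 hl
    -- `B` is the derivative of the pivot in direction `ξ`. Undoing the pivot therefore
    -- differentiates to `ξ + infAct X₀ (-B)`, and `B` vanishes at both ends because the pivot is
    -- constant there.
    set B : GaugeAlg r := fun k l l' =>
      fderiv ℝ (fun X => entryLin k l l' (pivot P X)) X₀ ξ with hB
    have hp : ∀ ℓ : GaugeAlg r →ₗ[ℝ] ℝ,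
        HasDerivAt (fun t : ℝ => ℓ (pivot P (X₀ + t • ξ))) (ℓ B) 0 :=
      hasDerivAt_linear_comp fun k l l' => hcomp (entryLin k l l')
    have hpi := gaugeAlg_hasDerivAt_ringInverse hp (by rw [hl0, hP0])
    have hconst : ∀ k, (∀ X, pivot P X k = 1) → B k = 0 := by
      intro k hk
      funext l l'
      have h2 : HasDerivAt (fun t : ℝ => pivot P (X₀ + t • ξ) k l l') (B k l l') 0 :=
        hp (entryLin k l l')
      simp only [hk] at h2
      exact h2.unique (hasDerivAt_const _ _)
    have h3 := hasDerivAt_act (B := -B) (by rwa [neg_neg]) hpi hl (by rw [hl0, hP0])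
      (by rw [hl0, hP0, Ring.inverse_one]) hl0
    have h4 : HasDerivAt (fun t : ℝ => normalForm P (X₀ + t • ξ))
        (fderiv ℝ (normalForm P) X₀ ξ) 0 := by
      have h := hdiff.hasFDerivAt
      rw [← hl0] at h
      simpa only [hl0] using! h.comp_hasDerivAt 0 hl
    rw [h4.unique h3, add_sub_cancel_left]
    exact ⟨⟨-B, by simp [gaugeLie, hconst 0 hP00, hconst _ hPl]⟩, rfl⟩
  -- A direction of the infinitesimal action is the velocity of a curve in the orbit, along which
  -- the normal form is constantly `X₀`.
  · rintro _ ⟨B, rfl⟩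
    obtain ⟨γ, -, hγ, hγ0, hγ'⟩ := exists_gauge_curve X₀ B
    have h4 : HasDerivAt (fun t : ℝ => normalForm P (γ t))
        (fderiv ℝ (normalForm P) X₀ (infActLin X₀ B)) 0 := by
      have h := hdiff.hasFDerivAt
      rw [← hγ0] at h
      simpa only [hγ0] using! h.comp_hasDerivAt 0 hγ'
    have h5 : (fun t : ℝ => normalForm P (γ t)) = fun _ => X₀ := funext fun t => by
      obtain ⟨A, hA⟩ := hγ t
      rw [hA, normalForm_theta, hν0]
    rw [h5] at h4
    exact h4.unique (hasDerivAt_const _ _)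

end NormalForm

end TensorTrain

/-! ### Local sections and local slices by the inverse function theorem -/

section Slice

open Set Filter Topology

variable {E F : Type*} [NormedAddCommGroup E] [NormedSpace ℝ E]
  [NormedAddCommGroup F] [NormedSpace ℝ F] [FiniteDimensional ℝ F]

/-- A linear left inverse of the derivative turns `f` into a map with derivative the identity, to
which the inverse function theorem applies. -/
theorem exists_injOn_of_hasStrictFDerivAt [FiniteDimensional ℝ E] {f : E → F}
    {f' : E →L[ℝ] F} {a : E}
    (hf : HasStrictFDerivAt f f' a) (hf' : ∀ v, f' v = 0 → v = 0) :
    ∃ O, IsOpen O ∧ a ∈ O ∧ InjOn f O := by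
  have : CompleteSpace E := FiniteDimensional.complete ℝ E
  obtain ⟨g, hg⟩ := f'.toLinearMap.exists_leftInverse_of_injective (LinearMap.ker_eq_bot'.2 hf')
  set G : F →L[ℝ] E := LinearMap.toContinuousLinearMap g
  have hG : G.comp f' = (ContinuousLinearEquiv.refl ℝ E : E →L[ℝ] E) := by
    ext v
    exact LinearMap.congr_fun hg v
  have h : HasStrictFDerivAt (G ∘ f) (ContinuousLinearEquiv.refl ℝ E : E →L[ℝ] E) a := by
    rw [← hG]
    exact G.hasStrictFDerivAt.comp a hf
  refine ⟨(h.toOpenPartialHomeomorph _).source, (h.toOpenPartialHomeomorph _).open_source,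
    h.mem_toOpenPartialHomeomorph_source, fun x hx y hy hxy => ?_⟩
  refine (h.toOpenPartialHomeomorph _).injOn hx hy ?_
  simp [hxy]

/-- A smooth map has a smooth local section through each point where its derivative is
surjective. -/
theorem exists_local_section {f : E → F} {N : Set E} (hN : IsOpen N) (hf : ContDiffOn ℝ ∞ f N)
    {a : E} (ha : a ∈ N) (hs : Function.Surjective (fderiv ℝ f a)) :
    ∃ (V : Set F) (s : F → E), IsOpen V ∧ f a ∈ V ∧ ContDiffOn ℝ ∞ s V ∧ MapsTo s V N ∧
      s (f a) = a ∧ ∀ w ∈ V, f (s w) = w := by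
  have : CompleteSpace F := FiniteDimensional.complete ℝ F
  obtain ⟨R', hR'⟩ := (fderiv ℝ f a).toLinearMap.exists_rightInverse_of_surjective
    (LinearMap.range_eq_top.2 hs)
  set R : F →L[ℝ] E := LinearMap.toContinuousLinearMap R'
  -- Restricted to this affine slice through `a`, the map `f` has derivative the identity at `f a`;
  -- the section is `g` after the local inverse of `f ∘ g`.
  set g : F → E := fun w => a + R (w - f a)
  have hg : ContDiff ℝ ∞ g := by fun_prop
  have hga : g (f a) = a := by simp [g]
  have hgd : HasFDerivAt g R (f a) :=
    (R.hasFDerivAt.comp (f a) ((hasFDerivAt_id (f a)).sub_const (f a))).const_add a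
  have hfa : ContDiffAt ℝ ∞ f a := hf.contDiffAt (hN.mem_nhds ha)
  set h : F → F := f ∘ g
  have hho : IsOpen (g ⁻¹' N) := hN.preimage hg.continuous
  have hh : ContDiffOn ℝ ∞ h (g ⁻¹' N) := hf.comp hg.contDiffOn fun _ hx => hx
  have hmem : f a ∈ g ⁻¹' N := by simpa [hga] using ha
  have hhd : HasFDerivAt h ((ContinuousLinearEquiv.refl ℝ F : F ≃L[ℝ] F) : F →L[ℝ] F) (f a) := by
    have h1 : HasFDerivAt f (fderiv ℝ f a) (g (f a)) := by
      rw [hga]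
      exact (hfa.differentiableAt (by simp)).hasFDerivAt
    convert! h1.comp (f a) hgd using 1
    ext v
    exact (LinearMap.congr_fun hR' v).symm
  have hhc : ContDiffAt ℝ ∞ h (f a) := hh.contDiffAt (hho.mem_nhds hmem)
  set e := hhc.toOpenPartialHomeomorph h hhd (by simp)
  have hea : e.symm (f a) = f a := by
    have h1 : e (f a) = f a := by
      change f (g (f a)) = f a
      rw [hga]
    conv_lhs => rw [← h1]
    exact e.left_inv (hhc.mem_toOpenPartialHomeomorph_source hhd (by simp))
  -- Keeping the derivative of `h` invertible makes the local inverse smooth on a whole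
  -- neighbourhood, not only at the centre.
  set U := g ⁻¹' N ∩ fderiv ℝ h ⁻¹' range ((↑) : (F ≃L[ℝ] F) → F →L[ℝ] F)
  have hU : IsOpen U :=
    (hh.continuousOn_fderiv_of_isOpen hho (by simp)).isOpen_inter_preimage hho
      ContinuousLinearEquiv.isOpen
  refine ⟨e.target ∩ e.symm ⁻¹' U, g ∘ e.symm, e.isOpen_inter_preimage_symm hU, ⟨?_, ?_⟩, ?_, ?_,
    ?_, ?_⟩
  · have := hhc.image_mem_toOpenPartialHomeomorph_target hhd (by simp)
    change f (g (f a)) ∈ _ at this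
    rwa [hga] at this
  · rw [mem_preimage, hea]
    exact ⟨hmem, ContinuousLinearEquiv.refl ℝ F, hhd.fderiv.symm⟩
  · rintro w ⟨hw, hwU, f', hf'⟩
    refine ContDiffAt.contDiffWithinAt (hg.contDiffAt.comp w ?_)
    have hc : ContDiffAt ℝ ∞ h (e.symm w) := hh.contDiffAt (hho.mem_nhds hwU)
    refine e.contDiffAt_symm hw (f₀' := f') ?_ hc
    rw [hf']
    exact (hc.differentiableAt (by simp)).hasFDerivAt
  · exact fun w hw => hw.2.1
  · change g (e.symm (f a)) = a
    rw [hea, hga]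
  · exact fun w hw => e.right_inv hw.1

/-- A smooth local retraction onto representatives of the classes of an equivalence relation gives
a local coordinate of the classes. -/
theorem exists_local_slice [FiniteDimensional ℝ E] {N₀ : Set E} {ν : E → E} {x₀ : E}
    (hN₀ : IsOpen N₀) (hx₀ : x₀ ∈ N₀)
    (hν : ContDiffOn ℝ ∞ ν N₀) (hνx₀ : ν x₀ = x₀)
    (hνν : ∀ x ∈ N₀, ν (ν x) = ν x) {L : E →L[ℝ] F} (hL : Function.Surjective L)
    (hLν : ∀ v, L (fderiv ℝ ν x₀ v) = L v) (hkL : ∀ v, L v = 0 → fderiv ℝ ν x₀ v = 0) :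
    ∃ (N : Set E) (κ : E → F) (V : Set F) (s : F → E), IsOpen N ∧ x₀ ∈ N ∧ N ⊆ N₀ ∧
      ContDiffOn ℝ ∞ κ N ∧ IsOpen V ∧ ContDiffOn ℝ ∞ s V ∧ MapsTo s V N ∧ MapsTo κ N V ∧
      (∀ w ∈ V, κ (s w) = w) ∧ s (κ x₀) = x₀ ∧ ∀ x ∈ N, ∀ y ∈ N, κ x = κ y ↔ ν x = ν y := by
  have hνx : ContDiffAt ℝ ∞ ν x₀ := hν.contDiffAt (hN₀.mem_nhds hx₀)
  have hνs : HasStrictFDerivAt ν (fderiv ℝ ν x₀) x₀ := hνx.hasStrictFDerivAt (by simp)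
  -- The map `x ↦ (L x, x - ν x)` is an immersion at `x₀`. On normal forms its second component
  -- vanishes, so near `x₀` they are separated by `L` alone.
  obtain ⟨O, hO, hxO, hinj⟩ := exists_injOn_of_hasStrictFDerivAt
    (f := fun x => (L x, x - ν x)) (L.hasStrictFDerivAt.prodMk ((hasStrictFDerivAt_id x₀).sub hνs))
    (fun v hv => by
      obtain ⟨h1, h2⟩ := Prod.ext_iff.1 hv
      have h3 : v - fderiv ℝ ν x₀ v = 0 := h2
      rwa [hkL v h1, sub_zero] at h3)
  set κ : E → F := fun x => L (ν x)
  have hκ : ContDiffOn ℝ ∞ κ N₀ := L.contDiff.comp_contDiffOn hν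
  have hκd : fderiv ℝ κ x₀ = L := by
    rw [(L.hasStrictFDerivAt.comp x₀ hνs).hasFDerivAt.fderiv]
    ext v
    exact hLν v
  obtain ⟨V, s, hV, hκV, hs, hsN, hsx, hκs⟩ := exists_local_section hN₀ hκ hx₀
    (by rw [hκd]; exact hL)
  have hνO : IsOpen (N₀ ∩ ν ⁻¹' O) := hν.continuousOn.isOpen_inter_preimage hN₀ hO
  set V' := V ∩ s ⁻¹' (N₀ ∩ ν ⁻¹' O)
  have hV' : IsOpen V' := hs.continuousOn.isOpen_inter_preimage hV hνO
  -- Domain and image are shrunk together so that `κ` and `s` map each into the other and all normal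
  -- forms stay in `O`.
  set N := (N₀ ∩ κ ⁻¹' V') ∩ (N₀ ∩ ν ⁻¹' O)
  have hN : IsOpen N := (hκ.continuousOn.isOpen_inter_preimage hN₀ hV').inter hνO
  refine ⟨N, κ, V', s, hN, ⟨⟨hx₀, hκV, ?_⟩, hx₀, ?_⟩, fun x hx => hx.2.1,
    hκ.mono fun x hx => hx.2.1, hV', hs.mono inter_subset_left, ?_, fun x hx => hx.1.2,
    fun w hw => hκs w hw.1, hsx, ?_⟩
  · rw [mem_preimage, hsx]
    exact ⟨hx₀, by rwa [mem_preimage, hνx₀]⟩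
  · rwa [mem_preimage, hνx₀]
  · intro w hw
    refine ⟨⟨hw.2.1, ?_⟩, hw.2⟩
    rw [mem_preimage, hκs w hw.1]
    exact hw
  · intro x hx y hy
    refine ⟨fun h => hinj hx.2.2 hy.2.2 ?_, fun h => by simp only [κ, h]⟩
    simp only [hνν x hx.2.1, hνν y hy.2.1, sub_self]
    exact Prod.ext h rfl

end Slice

/-! ### From local slices to a quotient manifold -/

section QuotientManifold

open Set Filter Topology

section Retract

variable {E : Type*} [TopologicalSpace E] {M : TopologicalSpace.Opens E}

open Classical in
/-- A left inverse of the inclusion of an open subset. -/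
def retract (x₀ : M) (x : E) : M := if h : x ∈ M then ⟨x, h⟩ else x₀

theorem retract_of_mem (x₀ : M) {x : E} (h : x ∈ M) : retract x₀ x = ⟨x, h⟩ := dif_pos h

@[simp] theorem retract_coe (x₀ x : M) : retract x₀ (x : E) = x := retract_of_mem x₀ x.2

end Retract

variable {E F : Type*} [NormedAddCommGroup E] [NormedSpace ℝ E]
  [NormedAddCommGroup F] [NormedSpace ℝ F] {M : TopologicalSpace.Opens E}

theorem contMDiffAt_retract (x₀ : M) {x : E} (h : x ∈ M) :
    ContMDiffAt 𝓘(ℝ, E) 𝓘(ℝ, E) ∞ (retract x₀) x := by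
  rw [← ContMDiffAt.subtypeVal_comp_iff]
  refine contMDiffAt_id.congr_of_eventuallyEq ?_
  filter_upwards [M.isOpen.mem_nhds h] with y hy
  simp [retract_of_mem x₀ hy]

theorem mfderiv_val (X : M) :
    mfderiv 𝓘(ℝ, E) 𝓘(ℝ, E) (Subtype.val : M → E) X = ContinuousLinearMap.id ℝ E := by
  exact mfderiv_extChartAt_self (I := 𝓘(ℝ, E)) (x := X)

variable {Q : Type*}

/-- A local slice of a map on an open set of a normed space: a smooth function separating exactly
the fibres of the map, with a smooth section. -/
structure LocalSlice (F : Type*) [NormedAddCommGroup F] [NormedSpace ℝ F] (p : M → Q) (X : M) where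
  /-- the domain of the coordinate -/
  dom : Set E
  /-- the coordinate -/
  coord : E → F
  /-- the image of the coordinate -/
  img : Set F
  /-- the section -/
  sec : F → E
  isOpen_dom : IsOpen dom
  mem_dom : X.1 ∈ dom
  dom_subset : dom ⊆ M
  contDiffOn_coord : ContDiffOn ℝ ∞ coord dom
  isOpen_img : IsOpen img
  contDiffOn_sec : ContDiffOn ℝ ∞ sec img
  mapsTo_sec : MapsTo sec img dom
  mapsTo_coord : MapsTo coord dom img
  coord_sec : ∀ w ∈ img, coord (sec w) = w
  sec_coord : sec (coord X.1) = X.1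
  coord_eq_iff : ∀ Y Z : M, Y.1 ∈ dom → Z.1 ∈ dom → (coord Y.1 = coord Z.1 ↔ p Y = p Z)

namespace LocalSlice

variable {p : M → Q} {X : M} (S : LocalSlice F p X)

open Classical in
/-- The coordinate of a point of the target. -/
def chartFun (q : Q) : F :=
  if h : ∃ Y : M, Y.1 ∈ S.dom ∧ p Y = q then S.coord h.choose.1 else 0

theorem chartFun_apply {Y : M} (hY : Y.1 ∈ S.dom) : S.chartFun (p Y) = S.coord Y.1 := by
  have h : ∃ Z : M, Z.1 ∈ S.dom ∧ p Z = p Y := ⟨Y, hY, rfl⟩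
  rw [chartFun, dif_pos h]
  exact (S.coord_eq_iff _ _ h.choose_spec.1 hY).2 h.choose_spec.2

variable [TopologicalSpace Q]

/-- The chart given by a local slice of an open map. -/
def chart (hc : Continuous p) (ho : IsOpenMap p) : OpenPartialHomeomorph Q F where
  toFun := S.chartFun
  invFun w := p (retract X (S.sec w))
  source := p '' (Subtype.val ⁻¹' S.dom)
  target := S.img
  map_source' := by
    rintro _ ⟨Y, hY, rfl⟩
    rw [S.chartFun_apply hY]
    exact S.mapsTo_coord hY
  map_target' w hw := by
    rw [retract_of_mem X (S.dom_subset (S.mapsTo_sec hw))]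
    exact ⟨_, S.mapsTo_sec hw, rfl⟩
  left_inv' := by
    rintro _ ⟨Y, hY, rfl⟩
    have hw := S.mapsTo_coord hY
    rw [S.chartFun_apply hY, retract_of_mem X (S.dom_subset (S.mapsTo_sec hw))]
    exact (S.coord_eq_iff _ _ (S.mapsTo_sec hw) hY).1 (S.coord_sec _ hw)
  right_inv' w hw := by
    have h := S.mapsTo_sec hw
    rw [retract_of_mem X (S.dom_subset h), S.chartFun_apply h]
    exact S.coord_sec w hw
  open_source := ho _ (S.isOpen_dom.preimage continuous_subtype_val)
  open_target := S.isOpen_img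
  continuousOn_toFun := by
    have hsrc := ho _ (S.isOpen_dom.preimage continuous_subtype_val)
    refine (continuousOn_open_iff hsrc).2 fun t ht => ?_
    have : p '' (Subtype.val ⁻¹' S.dom) ∩ S.chartFun ⁻¹' t =
        p '' (Subtype.val ⁻¹' (S.dom ∩ S.coord ⁻¹' t)) := by
      ext q
      constructor
      · rintro ⟨⟨Y, hY, rfl⟩, hq⟩
        rw [mem_preimage, S.chartFun_apply hY] at hq
        exact ⟨Y, ⟨hY, hq⟩, rfl⟩
      · rintro ⟨Y, ⟨hY, ht⟩, rfl⟩
        refine ⟨⟨Y, hY, rfl⟩, ?_⟩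
        rw [mem_preimage, S.chartFun_apply hY]
        exact ht
    rw [this]
    exact ho _ ((S.contDiffOn_coord.continuousOn.isOpen_inter_preimage S.isOpen_dom ht).preimage
      continuous_subtype_val)
  continuousOn_invFun := by
    intro w hw
    have h1 : ContinuousAt S.sec w :=
      S.contDiffOn_sec.continuousOn.continuousAt (S.isOpen_img.mem_nhds hw)
    have h2 : ContinuousAt (retract X) (S.sec w) :=
      (contMDiffAt_retract X (S.dom_subset (S.mapsTo_sec hw))).continuousAt
    exact (hc.continuousAt.comp (h2.comp h1)).continuousWithinAt

theorem chart_apply (hc : Continuous p) (ho : IsOpenMap p) {Y : M} (hY : Y.1 ∈ S.dom) :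
    S.chart hc ho (p Y) = S.coord Y.1 := S.chartFun_apply hY

end LocalSlice

variable [TopologicalSpace Q]

/-- If an open map has local slices everywhere, and its fibres are homogeneous under smooth maps
preserving the fibres, then the target is a manifold and the map a submersion. -/
theorem exists_quotient_manifold {p : M → Q} (hc : Continuous p) (ho : IsOpenMap p)
    (hp : Function.Surjective p) (S : ∀ X : M, LocalSlice F p X)
    (hθ : ∀ X Y : M, p X = p Y → ∃ θ : E → E, ContDiff ℝ ∞ θ ∧ θ X = Y ∧
      ∀ Z : M, ∃ h : θ Z ∈ M, p ⟨θ Z, h⟩ = p Z) :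
    ∃ _ : ChartedSpace F Q, IsManifold 𝓘(ℝ, F) ∞ Q ∧ ContMDiff 𝓘(ℝ, E) 𝓘(ℝ, F) ∞ p ∧
      ∀ X, Function.Surjective (mfderiv 𝓘(ℝ, E) 𝓘(ℝ, F) p X) := by
  let _ : ChartedSpace F Q :=
    { atlas := range fun X => (S X).chart hc ho
      chartAt := fun q => (S (Function.surjInv hp q)).chart hc ho
      mem_chart_source := fun q =>
        ⟨Function.surjInv hp q, (S _).mem_dom, Function.surjInv_eq hp q⟩
      chart_mem_atlas := fun q => mem_range_self _ }
  have hmfd : IsManifold 𝓘(ℝ, F) ∞ Q := by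
    refine isManifold_of_contDiffOn _ _ _ ?_
    rintro _ _ ⟨X, rfl⟩ ⟨Y, rfl⟩
    simp only [modelWithCornersSelf_coe, modelWithCornersSelf_coe_symm, Function.id_comp,
      Function.comp_id, preimage_id_eq, id_eq, range_id, inter_univ]
    rintro w ⟨hw, Y', hY', hwY'⟩
    have hw : w ∈ (S X).img := hw
    refine ContDiffAt.contDiffWithinAt ?_
    have hsw := (S X).mapsTo_sec hw
    set Z : M := ⟨(S X).sec w, (S X).dom_subset hsw⟩ with hZ
    have hpZ : p Z = p Y' := by
      have : p Y' = p (retract X ((S X).sec w)) := hwY'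
      rw [this, retract_of_mem X ((S X).dom_subset hsw)]
    -- The section over the first chart need not meet the domain of the second slice. A
    -- fibre-preserving smooth map moves it there, and the transition map becomes a composite of
    -- smooth maps.
    obtain ⟨θ, hθc, hθX, hθp⟩ := hθ Z Y' hpZ
    have hsc : ContDiffAt ℝ ∞ (S X).sec w :=
      (S X).contDiffOn_sec.contDiffAt ((S X).isOpen_img.mem_nhds hw)
    have hθs : ContDiffAt ℝ ∞ (fun w => θ ((S X).sec w)) w := hθc.contDiffAt.comp w hsc
    have hmem : θ ((S X).sec w) ∈ (S Y).dom := by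
      have : θ ((S X).sec w) = Y' := hθX
      rw [this]
      exact hY'
    have hcoord : ContDiffAt ℝ ∞ (fun w => (S Y).coord (θ ((S X).sec w))) w :=
      ((S Y).contDiffOn_coord.contDiffAt ((S Y).isOpen_dom.mem_nhds hmem)).comp w hθs
    refine hcoord.congr_of_eventuallyEq ?_
    filter_upwards [(S X).isOpen_img.mem_nhds hw,
      hθs.continuousAt.preimage_mem_nhds ((S Y).isOpen_dom.mem_nhds hmem)] with u hu hu'
    have hsu := (S X).dom_subset ((S X).mapsTo_sec hu)
    obtain ⟨h1, h2⟩ := hθp ⟨_, hsu⟩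
    change (S Y).chartFun (p (retract X ((S X).sec u))) = _
    rw [retract_of_mem X hsu, ← h2]
    exact (S Y).chartFun_apply hu'
  have hmax : ∀ X, (S X).chart hc ho ∈ IsManifold.maximalAtlas 𝓘(ℝ, F) ∞ Q := fun X =>
    IsManifold.subset_maximalAtlas (mem_range_self X)
  have hcoordX : ∀ X : M, ContMDiffAt 𝓘(ℝ, E) 𝓘(ℝ, F) ∞ (fun Y : M => (S X).coord Y.1) X :=
    fun X => contMDiffAt_subtype_iff.2 <| ContDiffAt.contMDiffAt <|
      (S X).contDiffOn_coord.contDiffAt ((S X).isOpen_dom.mem_nhds (S X).mem_dom)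
  have hnear : ∀ X : M, ∀ᶠ Y : M in 𝓝 X, Y.1 ∈ (S X).dom := fun X =>
    ((S X).isOpen_dom.preimage continuous_subtype_val).mem_nhds (S X).mem_dom
  have hsm : ContMDiff 𝓘(ℝ, E) 𝓘(ℝ, F) ∞ p := by
    intro X
    have h1 : ContMDiffAt 𝓘(ℝ, F) 𝓘(ℝ, F) ∞ ((S X).chart hc ho).symm ((S X).coord X.1) :=
      contMDiffAt_symm_of_mem_maximalAtlas (hmax X) ((S X).mapsTo_coord (S X).mem_dom)
    refine (ContMDiffAt.comp X h1 (hcoordX X)).congr_of_eventuallyEq ?_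
    filter_upwards [hnear X] with Y hY
    rw [Function.comp_apply, ← (S X).chart_apply hc ho hY, OpenPartialHomeomorph.left_inv]
    exact ⟨Y, hY, rfl⟩
  refine ⟨inferInstance, hmfd, hsm, fun X => ?_⟩
  have hw : (S X).coord X.1 ∈ ((S X).chart hc ho).symm.source :=
    (S X).mapsTo_coord (S X).mem_dom
  have hsurj := ((mdifferentiable_of_mem_atlas (I := 𝓘(ℝ, F))
    (show (S X).chart hc ho ∈ atlas F Q from mem_range_self X)).symm).mfderiv_surjective hw
  have hX : retract X ((S X).sec ((S X).coord X.1)) = X := by rw [(S X).sec_coord, retract_coe]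
  have h1 : MDifferentiableAt 𝓘(ℝ, F) 𝓘(ℝ, E) (retract X ∘ (S X).sec) ((S X).coord X.1) := by
    refine ContMDiffAt.mdifferentiableAt (n := ∞) (ContMDiffAt.comp _
      (contMDiffAt_retract X (by rw [(S X).sec_coord]; exact X.2)) ?_) (by simp)
    exact ((S X).contDiffOn_sec.contDiffAt ((S X).isOpen_img.mem_nhds hw)).contMDiffAt
  have h2 : MDifferentiableAt 𝓘(ℝ, E) 𝓘(ℝ, F) p
      ((retract X ∘ (S X).sec) ((S X).coord X.1)) :=
    (hsm _).mdifferentiableAt (by simp)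
  have h3 := mfderiv_comp _ h2 h1
  -- The inverse chart factors through `p`, so its surjective derivative forces that of `p` to be
  -- surjective at the value of the section, which is `X`.
  have h4 : p ∘ retract X ∘ (S X).sec = ((S X).chart hc ho).symm := rfl
  rw [h4] at h3
  rw [h3] at hsurj
  have h5 := Function.Surjective.of_comp (g := mfderiv 𝓘(ℝ, F) 𝓘(ℝ, E) (retract X ∘ (S X).sec)
    ((S X).coord X.1)) hsurj
  rwa [Function.comp_apply, hX] at h5

end QuotientManifold

/-! ### Linear algebra of the induced form on a quotient -/

section QuotientForm

variable {E F : Type*} [NormedAddCommGroup E] [NormedSpace ℝ E]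
  [NormedAddCommGroup F] [NormedSpace ℝ F]

theorem isInvertible_of_injective_of_finrank_eq [FiniteDimensional ℝ E] [FiniteDimensional ℝ F]
    {f : E →L[ℝ] F} (hf : ∀ v, f v = 0 → v = 0)
    (h : Module.finrank ℝ E = Module.finrank ℝ F) : f.IsInvertible := by
  refine ⟨(LinearEquiv.ofInjectiveOfFinrankEq f.toLinearMap ?_ h).toContinuousLinearEquiv, ?_⟩
  · exact LinearMap.ker_eq_bot.1 (LinearMap.ker_eq_bot'.2 hf)
  · ext v
    rfl

theorem finrank_dual_clm [FiniteDimensional ℝ F] :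
    Module.finrank ℝ (F →L[ℝ] ℝ) = Module.finrank ℝ F := by
  rw [← (LinearMap.toContinuousLinearMap (𝕜 := ℝ) (E := F) (F' := ℝ)).finrank_eq]
  exact Subspace.dual_finrank_eq

/-- A positive definite form on the source of a linear map. -/
structure PosDefForm (G : E →L[ℝ] E →L[ℝ] ℝ) : Prop where
  symm : ∀ v w, G v w = G w v
  pos : ∀ v, v ≠ 0 → 0 < G v v

/-- Vectors orthogonal to the kernel of a linear map. -/
def IsHorizontal (G : E →L[ℝ] E →L[ℝ] ℝ) (L : E →L[ℝ] F) (ξ : E) : Prop :=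
  ∀ v, L v = 0 → G ξ v = 0

/-- The pairing `L G⁻¹ Lᵀ` on the dual of the target of `L`. -/
def coForm (G : E →L[ℝ] E →L[ℝ] ℝ) (L : E →L[ℝ] F) : (F →L[ℝ] ℝ) →L[ℝ] F :=
  L ∘L G.inverse ∘L (ContinuousLinearMap.compL ℝ E F ℝ).flip L

/-- The form induced by `G` on the target of a surjective linear map `L`. -/
def quotForm (G : E →L[ℝ] E →L[ℝ] ℝ) (L : E →L[ℝ] F) : F →L[ℝ] F →L[ℝ] ℝ :=
  (coForm G L).inverse

variable {G : E →L[ℝ] E →L[ℝ] ℝ} {L : E →L[ℝ] F}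

theorem PosDefForm.eq_zero (hG : PosDefForm G) {v : E} (h : G v v = 0) : v = 0 := by
  by_contra hv
  exact (hG.pos v hv).ne' h

theorem PosDefForm.isInvertible [FiniteDimensional ℝ E] (hG : PosDefForm G) : G.IsInvertible :=
  isInvertible_of_injective_of_finrank_eq (fun v hv => hG.eq_zero (by rw [hv]; rfl))
    finrank_dual_clm.symm

theorem coForm_apply (l : F →L[ℝ] ℝ) : coForm G L l = L (G.inverse (l ∘L L)) := rfl

/-- Pairing `coForm G L l` with `l` gives `G u u` for `u = G⁻¹ (l ∘ L)`. If it vanishes then `u =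
0`, hence `l ∘ L = 0`, and `l = 0` by surjectivity. -/
theorem PosDefForm.isInvertible_coForm [FiniteDimensional ℝ E] [FiniteDimensional ℝ F]
    (hG : PosDefForm G) (hL : Function.Surjective L) :
    (coForm G L).IsInvertible := by
  refine isInvertible_of_injective_of_finrank_eq (fun l hl => ?_) finrank_dual_clm
  rw [coForm_apply] at hl
  have h1 : G (G.inverse (l ∘L L)) = l ∘L L := hG.isInvertible.self_apply_inverse _
  have h2 : G.inverse (l ∘L L) = 0 := hG.eq_zero (by simp [h1, hl])
  rw [h2, map_zero] at h1
  ext v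
  obtain ⟨w, rfl⟩ := hL v
  exact (congrArg (fun f : E →L[ℝ] ℝ => f w) h1).symm

theorem IsHorizontal.exists_factor [FiniteDimensional ℝ F] {ξ : E} (h : IsHorizontal G L ξ)
    (hL : Function.Surjective L) : ∃ l : F →L[ℝ] ℝ, G ξ = l ∘L L := by
  obtain ⟨R, hR⟩ := L.toLinearMap.exists_rightInverse_of_surjective (LinearMap.range_eq_top.2 hL)
  refine ⟨LinearMap.toContinuousLinearMap ((G ξ).toLinearMap ∘ₗ R), ?_⟩
  ext v
  have h1 : L (v - R (L v)) = 0 := by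
    rw [map_sub, sub_eq_zero]
    exact (LinearMap.congr_fun hR (L v)).symm
  have h2 := h _ h1
  rw [map_sub, sub_eq_zero] at h2
  exact h2

/-- Horizontality of `ξ` means `G ξ = l ∘ L` for some `l`. Then `coForm G L l = L ξ`, so the inverse
sends `L ξ` back to `l`. -/
theorem quotForm_apply [FiniteDimensional ℝ E] [FiniteDimensional ℝ F]
    (hG : PosDefForm G) (hL : Function.Surjective L) {ξ : E}
    (hξ : IsHorizontal G L ξ) (η : E) : quotForm G L (L ξ) (L η) = G ξ η := by
  obtain ⟨l, hl⟩ := hξ.exists_factor hL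
  have h1 : coForm G L l = L ξ := by
    rw [coForm_apply, ← hl, hG.isInvertible.inverse_apply_self]
  rw [quotForm, ← h1, (hG.isInvertible_coForm hL).inverse_apply_self, hl]
  rfl

theorem exists_isHorizontal [FiniteDimensional ℝ E] [FiniteDimensional ℝ F]
    (hG : PosDefForm G) (hL : Function.Surjective L) (v : F) :
    ∃ ξ, IsHorizontal G L ξ ∧ L ξ = v := by
  obtain ⟨l, hl⟩ := (hG.isInvertible_coForm hL).surjective v
  refine ⟨G.inverse (l ∘L L), fun w hw => ?_, hl⟩
  rw [hG.isInvertible.self_apply_inverse]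
  simp [hw]

theorem IsHorizontal.eq_of_apply_eq (hG : PosDefForm G) {ξ η : E} (hξ : IsHorizontal G L ξ)
    (hη : IsHorizontal G L η) (h : L ξ = L η) : ξ = η := by
  have h0 : L (ξ - η) = 0 := by rw [map_sub, h, sub_self]
  refine sub_eq_zero.1 (hG.eq_zero ?_)
  have h1 := hξ _ h0
  have h2 := hη _ h0
  rw [map_sub G]
  simp [h1, h2]

theorem PosDefForm.quotForm [FiniteDimensional ℝ E] [FiniteDimensional ℝ F]
    (hG : PosDefForm G) (hL : Function.Surjective L) :
    PosDefForm (quotForm G L) where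
  symm v w := by
    obtain ⟨ξ, hξ, rfl⟩ := exists_isHorizontal hG hL v
    obtain ⟨η, hη, rfl⟩ := exists_isHorizontal hG hL w
    rw [quotForm_apply hG hL hξ, quotForm_apply hG hL hη, hG.symm]
  pos v hv := by
    obtain ⟨ξ, hξ, rfl⟩ := exists_isHorizontal hG hL v
    rw [quotForm_apply hG hL hξ]
    refine hG.pos ξ ?_
    rintro rfl
    exact hv (map_zero L)

/-- Only composition and inversion of linear maps enter the formula, and inversion is smooth near
invertible maps; no choice of horizontal lifts has to be differentiated. -/
theorem ContDiffAt.quotForm [FiniteDimensional ℝ E] [FiniteDimensional ℝ F]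
    {P : Type*} [NormedAddCommGroup P] [NormedSpace ℝ P] {x : P}
    {G : P → E →L[ℝ] E →L[ℝ] ℝ} {L : P → E →L[ℝ] F} (hG : ContDiffAt ℝ ∞ G x)
    (hL : ContDiffAt ℝ ∞ L x) (hGx : PosDefForm (G x)) (hLx : Function.Surjective (L x)) :
    ContDiffAt ℝ ∞ (fun y => quotForm (G y) (L y)) x := by
  have : CompleteSpace E := FiniteDimensional.complete ℝ E
  have h1 : ContDiffAt ℝ ∞ (fun y => (G y).inverse) x :=
    (hGx.isInvertible.contDiffAt_map_inverse).comp x hG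
  have h2 : ContDiffAt ℝ ∞ (fun y => (ContinuousLinearMap.compL ℝ E F ℝ).flip (L y)) x :=
    (ContinuousLinearMap.contDiff _).contDiffAt.comp x hL
  have h3 : ContDiffAt ℝ ∞ (fun y => coForm (G y) (L y)) x := hL.clm_comp (h1.clm_comp h2)
  exact ((hGx.isInvertible_coForm hLx).contDiffAt_map_inverse).comp x h3

theorem PosDefForm.isVonNBounded [FiniteDimensional ℝ E] (hG : PosDefForm G) :
    Bornology.IsVonNBounded ℝ {v : E | G v v < 1} := by
  rw [NormedSpace.isVonNBounded_iff]
  have hcont : Continuous fun v => G v v := G.continuous.clm_apply continuous_id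
  have : ProperSpace E := FiniteDimensional.proper ℝ E
  rcases (Metric.sphere (0 : E) 1).eq_empty_or_nonempty with he | hne
  · have : Subsingleton E := by
      by_contra hns
      rw [not_subsingleton_iff_nontrivial] at hns
      exact (NormedSpace.sphere_nonempty (E := E) (x := 0) (r := 1)).2 zero_le_one |>.ne_empty he
    exact (Set.toFinite _).isBounded
  · obtain ⟨u, hu, hmin⟩ := (isCompact_sphere (0 : E) 1).exists_isMinOn hne hcont.continuousOn
    have hu0 : u ≠ 0 := by
      rintro rfl
      simp at hu
    have hc : 0 < G u u := hG.pos u hu0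
    -- With `G u u` the minimum on the unit sphere, homogeneity gives `G u u * ‖v‖ ^ 2 ≤ G v v`,
    -- whence this radius.
    refine (Metric.isBounded_ball (x := (0 : E)) (r := Real.sqrt (G u u)⁻¹)).subset fun v hv => ?_
    rw [mem_ball_zero_iff]
    refine Real.lt_sqrt_of_sq_lt ?_
    rcases eq_or_ne v 0 with rfl | hv0
    · simpa using hc
    have hn : 0 < ‖v‖ := norm_pos_iff.2 hv0
    have h1 : G u u ≤ G (‖v‖⁻¹ • v) (‖v‖⁻¹ • v) := hmin (by simp [norm_smul, hn.ne'])
    have h2 : G (‖v‖⁻¹ • v) (‖v‖⁻¹ • v) = (‖v‖ ^ 2)⁻¹ * G v v := by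
      simp
      ring
    rw [h2] at h1
    have h3 : G v v < 1 := hv
    rw [lt_inv_comm₀ (by positivity) hc]
    refine h1.trans_lt ?_
    exact mul_lt_of_lt_one_right (by positivity) h3

end QuotientForm

/-! ### Descent of an invariant metric along a submersion -/

section QuotientMetric

open Set Filter Topology

variable {E F : Type*} [NormedAddCommGroup E] [NormedSpace ℝ E]
  [NormedAddCommGroup F] [NormedSpace ℝ F]
  {M : TopologicalSpace.Opens E} {Q : Type*} [TopologicalSpace Q] [ChartedSpace F Q]

theorem hasMFDerivAt_retract (X₀ X : M) :
    HasMFDerivAt 𝓘(ℝ, E) 𝓘(ℝ, E) (retract X₀) X.1 (ContinuousLinearMap.id ℝ E) := by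
  have h1 : MDifferentiableAt 𝓘(ℝ, E) 𝓘(ℝ, E) (retract X₀) X.1 :=
    (contMDiffAt_retract X₀ X.2).mdifferentiableAt (by simp)
  have h2 : HasMFDerivAt 𝓘(ℝ, E) 𝓘(ℝ, E) (Subtype.val : M → E) (retract X₀ X.1)
      (ContinuousLinearMap.id ℝ E) := by
    rw [← mfderiv_val (retract X₀ X.1)]
    exact ((contMDiff_subtype_val (n := ∞) _).mdifferentiableAt (by simp)).hasMFDerivAt
  have h3 := h2.comp X.1 h1.hasMFDerivAt
  have h4 : HasMFDerivAt 𝓘(ℝ, E) 𝓘(ℝ, E) ((Subtype.val : M → E) ∘ retract X₀) X.1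
      (ContinuousLinearMap.id ℝ E) := by
    refine (hasMFDerivAt_id X.1).congr_of_eventuallyEq ?_
    filter_upwards [M.isOpen.mem_nhds X.2] with y hy
    simp [retract_of_mem X₀ hy]
  have h5 := hasMFDerivAt_unique h3 h4
  have h6 : mfderiv 𝓘(ℝ, E) 𝓘(ℝ, E) (retract X₀) X.1 = ContinuousLinearMap.id ℝ E := h5
  rw [← h6]
  exact h1.hasMFDerivAt

/-- The derivative of a map from an open set of a normed space to a manifold, as a linear map
between the model spaces. -/
def modelDeriv (F : Type*) [NormedAddCommGroup F] [NormedSpace ℝ F] [ChartedSpace F Q]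
    (p : M → Q) (X : M) : E →L[ℝ] F := mfderiv 𝓘(ℝ, E) 𝓘(ℝ, F) p X

theorem tangentMap_eq_mk_iff {p : M → Q} {X : M} {ξ : E} {q : Q} {v : TangentSpace 𝓘(ℝ, F) q} :
    tangentMap 𝓘(ℝ, E) 𝓘(ℝ, F) p ⟨X, ξ⟩ = ⟨q, v⟩ ↔
      p X = q ∧ modelDeriv F p X ξ = (v : F) := by
  constructor
  · intro h
    exact ⟨congrArg (fun x : TangentBundle 𝓘(ℝ, F) Q => x.1) h,
      congrArg (fun x : TangentBundle 𝓘(ℝ, F) Q => (x.2 : F)) h⟩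
  · rintro ⟨rfl, h⟩
    exact congrArg (fun w : TangentSpace 𝓘(ℝ, F) (p X) => (⟨p X, w⟩ : TangentBundle 𝓘(ℝ, F) Q)) h

theorem isOpen_chart_comp {p : M → Q} (hp : ContMDiff 𝓘(ℝ, E) 𝓘(ℝ, F) ∞ p) (X₀ : M)
    (q₀ : Q) : IsOpen {x | x ∈ M ∧ p (retract X₀ x) ∈ (chartAt F q₀).source} := by
  have : {x | x ∈ M ∧ p (retract X₀ x) ∈ (chartAt F q₀).source} =
      Subtype.val '' (p ⁻¹' (chartAt F q₀).source) := by
    ext x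
    constructor
    · rintro ⟨hx, hx'⟩
      exact ⟨⟨x, hx⟩, by rwa [retract_of_mem X₀ hx] at hx', rfl⟩
    · rintro ⟨X, hX, rfl⟩
      exact ⟨X.2, by rwa [retract_coe]⟩
  rw [this]
  exact M.isOpen.isOpenMap_subtype_val _ ((chartAt F q₀).open_source.preimage hp.continuous)

variable [IsManifold 𝓘(ℝ, F) ∞ Q]

/-- The derivative of a chart at a point of its domain, as a linear map of the model space. -/
def chartDeriv (F : Type*) [NormedAddCommGroup F] [NormedSpace ℝ F] [ChartedSpace F Q]
    (q₀ q : Q) : F →L[ℝ] F := mfderiv 𝓘(ℝ, F) 𝓘(ℝ, F) (extChartAt 𝓘(ℝ, F) q₀) q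

theorem chartDeriv_bijective {q₀ q : Q} (hq : q ∈ (chartAt F q₀).source) :
    Function.Bijective (chartDeriv F q₀ q) :=
  (isInvertible_mfderiv_extChartAt (I := 𝓘(ℝ, F)) (x := q₀) (y := q) (by simpa using hq)).bijective

theorem fderiv_chart_comp {p : M → Q} (hp : ContMDiff 𝓘(ℝ, E) 𝓘(ℝ, F) ∞ p) (X₀ : M) (q₀ : Q)
    (X : M) (hX : p X ∈ (chartAt F q₀).source) :
    fderiv ℝ (fun x => extChartAt 𝓘(ℝ, F) q₀ (p (retract X₀ x))) X.1 =
      chartDeriv F q₀ (p X) ∘L modelDeriv F p X := by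
  have h1 : HasMFDerivAt 𝓘(ℝ, E) 𝓘(ℝ, F) p (retract X₀ X.1)
      (modelDeriv (E := E) F p X) := by
    rw [retract_coe]
    exact ((hp _).mdifferentiableAt (by simp)).hasMFDerivAt
  have h2 : HasMFDerivAt 𝓘(ℝ, F) 𝓘(ℝ, F) (extChartAt 𝓘(ℝ, F) q₀) ((p ∘ retract X₀) X.1)
      (chartDeriv F q₀ (p X)) := by
    rw [Function.comp_apply, retract_coe]
    exact (mdifferentiableAt_extChartAt hX).hasMFDerivAt
  have h3 := HasMFDerivAt.comp X.1 h2 (h1.comp X.1 (hasMFDerivAt_retract X₀ X))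
  have h4 : HasFDerivAt (fun x => extChartAt 𝓘(ℝ, F) q₀ (p (retract X₀ x)))
    (chartDeriv F q₀ (p X) ∘L modelDeriv F p X) X.1 := hasMFDerivAt_iff_hasFDerivAt.1 h3
  exact h4.fderiv

theorem contDiffOn_chart_comp {p : M → Q} (hp : ContMDiff 𝓘(ℝ, E) 𝓘(ℝ, F) ∞ p) (X₀ : M)
    (q₀ : Q) : ContDiffOn ℝ ∞ (fun x => extChartAt 𝓘(ℝ, F) q₀ (p (retract X₀ x)))
      {x | x ∈ M ∧ p (retract X₀ x) ∈ (chartAt F q₀).source} := by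
  rintro x ⟨hx, hx'⟩
  refine ContDiffAt.contDiffWithinAt (ContMDiffAt.contDiffAt ?_)
  exact (contMDiffAt_extChartAt' hx').comp x ((hp _).comp x (contMDiffAt_retract X₀ hx))

/-- The trivialization of the tangent bundle at `q₀` is the derivative of the chart at `q₀`, so `f`
is the coordinate expression of the section `b`. -/
theorem contMDiffAt_tangent_form
    {b : ∀ q : Q, TangentSpace 𝓘(ℝ, F) q →L[ℝ] TangentSpace 𝓘(ℝ, F) q →L[ℝ] ℝ} {q₀ : Q}
    {f : Q → F →L[ℝ] F →L[ℝ] ℝ} (hf : ContMDiffAt 𝓘(ℝ, F) 𝓘(ℝ, F →L[ℝ] F →L[ℝ] ℝ) ∞ f q₀)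
    (h : ∀ᶠ q in 𝓝 q₀, ∀ v w : TangentSpace 𝓘(ℝ, F) q,
      b q v w = f q (chartDeriv F q₀ q v) (chartDeriv F q₀ q w)) :
    ContMDiffAt 𝓘(ℝ, F) (𝓘(ℝ, F).prod 𝓘(ℝ, F →L[ℝ] F →L[ℝ] ℝ)) ∞
      (fun q ↦ Bundle.TotalSpace.mk' (F →L[ℝ] F →L[ℝ] ℝ)
        (E := fun q : Q => TangentSpace 𝓘(ℝ, F) q →L[ℝ] TangentSpace 𝓘(ℝ, F) q →L[ℝ] ℝ)
        q (b q)) q₀ := by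
  rw [Bundle.contMDiffAt_section]
  refine hf.congr_of_eventuallyEq ?_
  filter_upwards [h, (chartAt F q₀).open_source.mem_nhds (mem_chart_source F q₀)] with q hq hq'
  ext v w
  have hb : q ∈ (trivializationAt F (TangentSpace 𝓘(ℝ, F)) q₀).baseSet := hq'
  have key : ∀ v : F, chartDeriv F q₀ q
      ((trivializationAt F (TangentSpace 𝓘(ℝ, F)) q₀).symm q v) = v := by
    intro v
    have := (trivializationAt F (TangentSpace 𝓘(ℝ, F)) q₀).continuousLinearMapAt_symmL (R := ℝ)
      hb v
    rw [TangentBundle.continuousLinearMapAt_trivializationAt hq',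
      Bundle.Trivialization.symmL_apply] at this
    · exact this
    · exact hb
  rw [hom_trivializationAt_apply, inCoordinates_apply_eq₂ hb hb (Set.mem_univ _), hq, key, key]
  simp

/-- A smooth family of positive definite forms on the source of a submersion that is invariant
under a transitive family of transformations of its fibres induces a Riemannian metric on the
target. -/
theorem exists_quotient_metric [FiniteDimensional ℝ E] [FiniteDimensional ℝ F] {p : M → Q}
    (hp : ContMDiff 𝓘(ℝ, E) 𝓘(ℝ, F) ∞ p) (hs : Function.Surjective p)
    (hD : ∀ X, Function.Surjective (modelDeriv F p X)) {G : E → E →L[ℝ] E →L[ℝ] ℝ}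
    (hGc : ContDiffOn ℝ ∞ G M) (hG : ∀ X : M, PosDefForm (G X.1))
    (hθ : ∀ X Y : M, p X = p Y → ∃ θ : E → E, Function.Surjective θ ∧
      (∀ ξ, modelDeriv F p Y (θ ξ) = modelDeriv F p X ξ) ∧
      ∀ ξ η, G Y.1 (θ ξ) (θ η) = G X.1 ξ η) :
    ∃ g : Bundle.ContMDiffRiemannianMetric 𝓘(ℝ, F) ∞ F
        (fun q : Q => TangentSpace 𝓘(ℝ, F) q),
      ∀ (X : M) (ξ η : E), IsHorizontal (G X.1) (modelDeriv F p X) ξ →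
        IsHorizontal (G X.1) (modelDeriv F p X) η →
        g.inner (p X) (modelDeriv F p X ξ) (modelDeriv F p X η) = G X.1 ξ η := by
  set b : Q → F →L[ℝ] F →L[ℝ] ℝ := fun q =>
    quotForm (G (Function.surjInv hs q).1) (modelDeriv F p (Function.surjInv hs q)) with hbdef
  have hbpos : ∀ q, PosDefForm (b q) := fun q => (hG _).quotForm (hD _)
  have hb : ∀ (X : M) (ξ η : E), IsHorizontal (G X.1) (modelDeriv F p X) ξ →
      b (p X) (modelDeriv F p X ξ) (modelDeriv F p X η) = G X.1 ξ η := by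
    intro X ξ η hξ
    -- `b` is defined through an arbitrary choice of preimages; an isometry commuting with the
    -- derivative of `p` carries the chosen one to `X`.
    obtain ⟨θ, hθs, hθD, hθG⟩ := hθ (Function.surjInv hs (p X)) X (Function.surjInv_eq hs _)
    obtain ⟨ξ, rfl⟩ := hθs ξ
    obtain ⟨η, rfl⟩ := hθs η
    rw [hθD, hθD, hθG]
    refine quotForm_apply (hG _) (hD _) (fun v hv => ?_) η
    rw [← hθG]
    exact hξ _ (by rw [hθD, hv])
  refine ⟨⟨b, fun q => (hbpos q).symm, fun q => (hbpos q).pos, fun q => (hbpos q).isVonNBounded,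
    fun q₀ => ?_⟩, fun X ξ η hξ _ => hb X ξ η hξ⟩
  obtain ⟨X₀, rfl⟩ := hs q₀
  set f : E → F := fun x => extChartAt 𝓘(ℝ, F) (p X₀) (p (retract X₀ x)) with hf
  set N : Set E := {x | x ∈ M ∧ p (retract X₀ x) ∈ (chartAt F (p X₀)).source}
  have hN : IsOpen N := isOpen_chart_comp hp X₀ (p X₀)
  have hfN : ContDiffOn ℝ ∞ f N := contDiffOn_chart_comp hp X₀ (p X₀)
  have hX₀ : X₀.1 ∈ N := ⟨X₀.2, by simp⟩
  have hfd : ∀ X : M, X.1 ∈ N → fderiv ℝ f X.1 =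
      chartDeriv F (p X₀) (p X) ∘L modelDeriv F p X ∧ p X ∈ (chartAt F (p X₀)).source := by
    rintro X ⟨-, hX⟩
    rw [retract_coe] at hX
    exact ⟨fderiv_chart_comp hp X₀ (p X₀) X hX, hX⟩
  have hfs : ∀ X : M, X.1 ∈ N → Function.Surjective (fderiv ℝ f X.1) := by
    intro X hX
    rw [(hfd X hX).1]
    exact (chartDeriv_bijective (hfd X hX).2).surjective.comp (hD X)
  obtain ⟨V, s, hV, hfV, hsV, hsN, hsf, hfs'⟩ := exists_local_section hN hfN hX₀ (hfs X₀ hX₀)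
  have hfX₀ : f X₀.1 = extChartAt 𝓘(ℝ, F) (p X₀) (p X₀) := by simp [hf]
  have hsX₀ : s (extChartAt 𝓘(ℝ, F) (p X₀) (p X₀)) = X₀.1 := by rw [← hfX₀, hsf]
  rw [hfX₀] at hfV
  -- For smoothness the arbitrary preimages are replaced by the smooth local section `s`, with the
  -- map read in a chart.
  set h : F → F →L[ℝ] F →L[ℝ] ℝ := fun w => quotForm (G (s w)) (fderiv ℝ f (s w))
  have hh : ContDiffAt ℝ ∞ h (extChartAt 𝓘(ℝ, F) (p X₀) (p X₀)) := by
    have hsc : ContDiffAt ℝ ∞ s (extChartAt 𝓘(ℝ, F) (p X₀) (p X₀)) :=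
      hsV.contDiffAt (hV.mem_nhds hfV)
    refine ContDiffAt.quotForm (ContDiffAt.comp _ ?_ hsc) (ContDiffAt.comp _ ?_ hsc) ?_ ?_
    · rw [hsX₀]
      exact hGc.contDiffAt (M.isOpen.mem_nhds X₀.2)
    · rw [hsX₀]
      exact (hfN.contDiffAt (hN.mem_nhds hX₀)).fderiv_right (by simp)
    · rw [hsX₀]
      exact hG X₀
    · rw [hsX₀]
      exact hfs X₀ hX₀
  refine contMDiffAt_tangent_form (f := fun q => h (extChartAt 𝓘(ℝ, F) (p X₀) q))
    (hh.contMDiffAt.comp (p X₀) contMDiffAt_extChartAt) ?_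
  filter_upwards [(chartAt F (p X₀)).open_source.mem_nhds (mem_chart_source F (p X₀)),
    (continuousAt_extChartAt (I := 𝓘(ℝ, F)) (p X₀)).preimage_mem_nhds (hV.mem_nhds hfV)]
    with q hq hqV v w
  set X : M := ⟨s (extChartAt 𝓘(ℝ, F) (p X₀) q), (hsN hqV).1⟩ with hXdef
  have hXN : X.1 ∈ N := hsN hqV
  have hpX : p X = q := by
    have h1 : f X.1 = extChartAt 𝓘(ℝ, F) (p X₀) q := hfs' _ hqV
    have h2 : extChartAt 𝓘(ℝ, F) (p X₀) (p X) = extChartAt 𝓘(ℝ, F) (p X₀) q := by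
      rw [← h1, hf]
      simp only [retract_coe]
    refine (extChartAt 𝓘(ℝ, F) (p X₀)).injOn ?_ ?_ h2
    · rw [extChartAt_source]
      exact (hfd X hXN).2
    · rwa [extChartAt_source]
  have hfX := (hfd X hXN).1
  have hbij := chartDeriv_bijective (hfd X hXN).2
  change b q v w = quotForm (G X.1) (fderiv ℝ f X.1) _ _
  obtain ⟨ξ, hξ, hξv⟩ := exists_isHorizontal (hG X) (hD X) (v : F)
  obtain ⟨η, hη, hηw⟩ := exists_isHorizontal (hG X) (hD X) (w : F)
  -- The chart derivative is bijective, so `f` and `p` have the same kernel and hence the same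
  -- horizontal vectors.
  have hξ' : IsHorizontal (G X.1) (fderiv ℝ f X.1) ξ := fun u hu => hξ u <| by
    rw [hfX] at hu
    exact hbij.injective (hu.trans (map_zero _).symm)
  have e1 : chartDeriv F (p X₀) q v = fderiv ℝ f X.1 ξ := by
    rw [hfX, ContinuousLinearMap.comp_apply, hξv, hpX]
  have e2 : chartDeriv F (p X₀) q w = fderiv ℝ f X.1 η := by
    rw [hfX, ContinuousLinearMap.comp_apply, hηw, hpX]
  rw [e1, e2, quotForm_apply (hG X) (hfs X hXN) hξ' η, ← hb X ξ η hξ, hξv, hηw, hpX]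

end QuotientMetric

/-! ### The tensor train quotient: topology, atlas and vertical directions -/

namespace TensorTrain

open Set Filter Topology

variable {d : ℕ} {n : Fin d → ℕ} {r : Fin (d + 1) → ℕ}

theorem proj_eq_iff {X Y : totalSpace n r} : proj X = proj Y ↔ phi X.1 = phi Y.1 :=
  Quotient.eq (r := equivSetoid n r)

theorem proj_eq_iff_theta (h0 : r 0 = 1) (h1 : r (Fin.last d) = 1) {X Y : totalSpace n r} :
    proj X = proj Y ↔ ∃ A : gaugeGroup r, Y.1 = theta A X.1 := by
  rw [proj_eq_iff]
  refine ⟨exists_theta_of_phi_eq X.2 Y.2 h0 h1, ?_⟩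
  rintro ⟨A, hA⟩
  rw [hA, phi_theta]

theorem proj_surjective : Function.Surjective (proj : totalSpace n r → QuotientSpace n r) :=
  Quotient.mk_surjective

theorem isQuotientMap_proj :
    IsQuotientMap (proj : totalSpace n r → QuotientSpace n r) :=
  isQuotientMap_quot_mk

/-- The action of a gauge transformation as a continuous linear map. -/
def thetaCLM (A : gaugeGroup r) : Cores n r →L[ℝ] Cores n r :=
  LinearMap.toContinuousLinearMap (thetaLin A)

@[simp] theorem thetaCLM_apply (A : gaugeGroup r) (Z : Cores n r) : thetaCLM A Z = theta A Z := rfl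

/-- The action of a gauge transformation on the total space. -/
def thetaTotal (A : gaugeGroup r) (X : totalSpace n r) : totalSpace n r :=
  ⟨theta A X.1, fullRank_theta A X.2⟩

theorem proj_thetaTotal (A : gaugeGroup r) (X : totalSpace n r) :
    proj (thetaTotal A X) = proj X :=
  proj_eq_iff.2 (phi_theta A X.1)

theorem continuous_thetaTotal (A : gaugeGroup r) :
    Continuous (thetaTotal A : totalSpace n r → totalSpace n r) :=
  ((thetaCLM A).continuous.comp continuous_subtype_val).subtype_mk _

/-- The saturation of an open set is the union of its preimages under the continuous gauge
transformations. -/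
theorem isOpenMap_proj (h0 : r 0 = 1) (h1 : r (Fin.last d) = 1) :
    IsOpenMap (proj : totalSpace n r → QuotientSpace n r) := by
  intro U hU
  rw [← isQuotientMap_proj.isOpen_preimage]
  have : proj ⁻¹' (proj '' U) = ⋃ A : gaugeGroup r, thetaTotal A ⁻¹' U := by
    ext X
    simp only [mem_preimage, mem_image, mem_iUnion]
    constructor
    · rintro ⟨Y, hY, hYX⟩
      obtain ⟨A, hA⟩ := (proj_eq_iff_theta h0 h1).1 hYX.symm
      refine ⟨A, ?_⟩
      rwa [show thetaTotal A X = Y from Subtype.ext hA.symm]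
    · rintro ⟨A, hA⟩
      exact ⟨_, hA, proj_thetaTotal A X⟩
  rw [this]
  exact isOpen_iUnion fun A => hU.preimage (continuous_thetaTotal A)

theorem t2Space_quotientSpace (n : Fin d → ℕ) (r : Fin (d + 1) → ℕ) :
    T2Space (QuotientSpace n r) := by
  let f : QuotientSpace n r → Tensor n :=
    Quotient.lift (s := equivSetoid n r) (fun X => phi X.1) fun _ _ h => h
  have hf : Continuous f :=
    isQuotientMap_proj.continuous_iff.2 (contDiff_phi.continuous.comp continuous_subtype_val)
  refine T2Space.of_injective_continuous (f := f) ?_ hf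
  intro p q hpq
  obtain ⟨X, rfl⟩ := proj_surjective p
  obtain ⟨Y, rfl⟩ := proj_surjective q
  exact proj_eq_iff.2 hpq

theorem secondCountable_quotientSpace (h0 : r 0 = 1) (h1 : r (Fin.last d) = 1) :
    SecondCountableTopology (QuotientSpace n r) :=
  isQuotientMap_proj.secondCountableTopology (isOpenMap_proj h0 h1)

theorem exists_surjective_ker_eq {X : Cores n r} (hX : FullRank X) :
    ∃ L : Cores n r →L[ℝ] QuotientModel n r, Function.Surjective L ∧
      ∀ v, L v = 0 ↔ v ∈ LinearMap.range (infActLin X) := by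
  have h1 := finrank_range_infActLin hX
  have h2 := (LinearMap.range (infActLin X)).finrank_quotient_add_finrank
  have h3 : Module.finrank ℝ (Cores n r ⧸ LinearMap.range (infActLin X)) =
      Module.finrank ℝ (QuotientModel n r) := by
    rw [finrank_euclideanSpace_fin]
    omega
  let e := LinearEquiv.ofFinrankEq _ _ h3
  refine ⟨LinearMap.toContinuousLinearMap
    (e.toLinearMap ∘ₗ (LinearMap.range (infActLin X)).mkQ), ?_, fun v => ?_⟩
  · exact e.surjective.comp (Submodule.mkQ_surjective _)
  · exact e.map_eq_zero_iff.trans (Submodule.Quotient.mk_eq_zero _)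

/-- Near `X`, two tuples represent the same tensor exactly when their normal forms agree, so the
slice of the normal form separates the classes. -/
theorem nonempty_localSlice (h0 : r 0 = 1) (h1 : r (Fin.last d) = 1) (X : totalSpace n r) :
    Nonempty (LocalSlice (QuotientModel n r) (proj : totalSpace n r → QuotientSpace n r) X) := by
  obtain ⟨N₀, ν, hN₀, hX, hNM, hν, hνX, hνθ, hνinv, hν1, hν2⟩ := exists_normalForm X.2 h0 h1
  obtain ⟨L, hL, hkL⟩ := exists_surjective_ker_eq X.2
  obtain ⟨N, κ, V, s, hN, hXN, hNN, hκ, hV, hs, hsV, hκN, hκs, hsκ, hiff⟩ :=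
    exists_local_slice hN₀ hX hν hνX
    (fun Y hY => by
      obtain ⟨A, hA⟩ := hνθ Y hY
      conv_lhs => rw [hA]
      exact hνinv A Y) hL
    (fun v => by
      have := (hkL _).2 (hν1 v)
      rwa [map_sub, sub_eq_zero] at this)
    (fun v hv => hν2 v ((hkL v).1 hv))
  refine ⟨⟨N, κ, V, s, hN, hXN, fun Y hY => hNM Y (hNN hY), hκ, hV, hs, hsV, hκN, hκs, hsκ,
    fun Y Z hY hZ => (hiff Y hY Z hZ).trans ?_⟩⟩
  rw [proj_eq_iff]
  constructor
  · intro h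
    obtain ⟨A, hA⟩ := hνθ Y.1 (hNN hY)
    obtain ⟨B, hB⟩ := hνθ Z.1 (hNN hZ)
    rw [← phi_theta A Y.1, ← hA, h, hB, phi_theta]
  · intro h
    obtain ⟨A, hA⟩ := exists_theta_of_phi_eq Y.2 Z.2 h0 h1 h
    rw [hA, hνinv]

theorem exists_isQuotientManifold (h0 : r 0 = 1) (h1 : r (Fin.last d) = 1) :
    ∃ _ : ChartedSpace (QuotientModel n r) (QuotientSpace n r), IsQuotientManifold n r := by
  obtain ⟨c, h2, h3, h4⟩ := exists_quotient_manifold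
    (isQuotientMap_proj (n := n) (r := r)).continuous (isOpenMap_proj h0 h1) proj_surjective
    (fun X => (nonempty_localSlice h0 h1 X).some)
    (fun X Y hXY => by
      obtain ⟨A, hA⟩ := (proj_eq_iff_theta h0 h1).1 hXY
      exact ⟨theta A, (thetaCLM A).contDiff, hA.symm, fun Z =>
        ⟨fullRank_theta A Z.2, proj_thetaTotal A Z⟩⟩)
  exact ⟨c, h2, h3, h4⟩

theorem mem_verticalSpace_of_mem_range {X : totalSpace n r} {v : Cores n r}
    (hv : v ∈ LinearMap.range (infActLin X.1)) : v ∈ verticalSpace X := by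
  obtain ⟨B, rfl⟩ := hv
  obtain ⟨γ, hγ, hγX, hγ0, hγ'⟩ := exists_gauge_curve X.1 B
  refine ⟨γ, hγ, fun t => ?_, hγ0, hγ'.deriv⟩
  obtain ⟨A, hA⟩ := hγX t
  have hm : γ t ∈ totalSpace n r := by
    rw [hA]
    exact fullRank_theta A X.2
  refine ⟨hm, proj_eq_iff.2 ?_⟩
  change phi (γ t) = _
  rw [hA, phi_theta]

theorem posDefForm_metricCLM (h0 : r 0 = 1) (h1 : r (Fin.last d) = 1) (X : totalSpace n r) :
    PosDefForm (metricCLM X.1) :=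
  ⟨metricCLM_symm X.1, fun _ hv => metricCLM_pos X.2 h0 h1 hv⟩

/-! ### Horizontal lifts and the induced metric for any quotient manifold structure -/

section Structure

variable [ChartedSpace (QuotientModel n r) (QuotientSpace n r)]

theorem hasMFDerivAt_proj_retract (h : IsQuotientManifold n r) (X₀ X : totalSpace n r) :
    HasMFDerivAt 𝓘(ℝ, Cores n r) 𝓘(ℝ, QuotientModel n r) (proj ∘ retract X₀) X.1
      (modelDeriv (E := Cores n r) (QuotientModel n r) proj X) := by
  have h1 : HasMFDerivAt 𝓘(ℝ, Cores n r) 𝓘(ℝ, QuotientModel n r) proj (retract X₀ X.1)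
      (modelDeriv (E := Cores n r) (QuotientModel n r) proj X) := by
    rw [retract_coe]
    exact ((h.contMDiff_proj _).mdifferentiableAt (by simp)).hasMFDerivAt
  exact h1.comp X.1 (hasMFDerivAt_retract X₀ X)

/-- The derivative of the identity `π ∘ θ_A = π`, with `θ_A` linear. -/
theorem modelDeriv_theta (h : IsQuotientManifold n r) (A : gaugeGroup r) {X Y : totalSpace n r}
    (hY : Y.1 = theta A X.1) (ξ : Cores n r) :
    modelDeriv (QuotientModel n r) proj Y (theta A ξ) =
      modelDeriv (QuotientModel n r) proj X ξ := by
  have h1 : HasMFDerivAt 𝓘(ℝ, Cores n r) 𝓘(ℝ, QuotientModel n r) (proj ∘ retract X)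
      (thetaCLM A X.1) (modelDeriv (E := Cores n r) (QuotientModel n r) proj Y) := by
    rw [thetaCLM_apply, ← hY]
    exact hasMFDerivAt_proj_retract h X Y
  have h2 := h1.comp X.1 (thetaCLM A).hasMFDerivAt
  have h3 := (hasMFDerivAt_proj_retract h X X).congr_of_eventuallyEq
    (f₁ := (proj ∘ retract X) ∘ thetaCLM A) <| by
      filter_upwards [(totalSpace n r).isOpen.mem_nhds X.2] with Z hZ
      simp only [Function.comp_apply, thetaCLM_apply]
      rw [retract_of_mem X hZ,
        retract_of_mem X (show theta A Z ∈ totalSpace n r from fullRank_theta A hZ)]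
      exact proj_thetaTotal A ⟨Z, hZ⟩
  exact congrArg (fun f : Cores n r →L[ℝ] QuotientModel n r => f ξ) (hasMFDerivAt_unique h2 h3)

theorem modelDeriv_of_mem_verticalSpace (h : IsQuotientManifold n r) {X : totalSpace n r}
    {v : Cores n r} (hv : v ∈ verticalSpace X) : modelDeriv (QuotientModel n r) proj X v = 0 := by
  obtain ⟨γ, hγ, hγX, hγ0, rfl⟩ := hv
  have h1 : HasMFDerivAt 𝓘(ℝ, Cores n r) 𝓘(ℝ, QuotientModel n r) (proj ∘ retract X)
      (γ 0) (modelDeriv (E := Cores n r) (QuotientModel n r) proj X) := by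
    rw [hγ0]
    exact hasMFDerivAt_proj_retract h X X
  have h2 : HasMFDerivAt 𝓘(ℝ, ℝ) 𝓘(ℝ, Cores n r) γ 0 (fderiv ℝ γ 0) :=
    ((hγ.differentiable (by simp)) 0).hasFDerivAt.hasMFDerivAt
  have h3 := h1.comp 0 h2
  have h4 : (proj ∘ retract X) ∘ γ = fun _ => proj X := by
    funext t
    obtain ⟨ht, ht'⟩ := hγX t
    rw [Function.comp_apply, Function.comp_apply, retract_of_mem X ht, ht']
  rw [h4] at h3
  have h5 := hasMFDerivAt_unique h3 (hasMFDerivAt_const (proj X) (0 : ℝ))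
  exact congrArg (fun f : ℝ →L[ℝ] QuotientModel n r => f 1) h5

theorem modelDeriv_surjective (h : IsQuotientManifold n r) (X : totalSpace n r) :
    Function.Surjective (modelDeriv (QuotientModel n r) proj X) :=
  h.surjective_mfderiv_proj X

/-- The vertical space is the kernel of the derivative of the projection. -/
theorem mem_verticalSpace_iff (h : IsQuotientManifold n r) {X : totalSpace n r} {v : Cores n r} :
    v ∈ verticalSpace X ↔ modelDeriv (QuotientModel n r) proj X v = 0 := by
  refine ⟨modelDeriv_of_mem_verticalSpace h, fun hv => mem_verticalSpace_of_mem_range ?_⟩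
  set D := (modelDeriv (QuotientModel n r) proj X).toLinearMap
  -- The infinitesimal orbit directions lie in the kernel, and both spaces have codimension
  -- `quotientDim n r`, so they coincide.
  have hle : LinearMap.range (infActLin X.1) ≤ LinearMap.ker D := fun u hu =>
    modelDeriv_of_mem_verticalSpace h (mem_verticalSpace_of_mem_range hu)
  have h1 := D.finrank_range_add_finrank_ker
  rw [LinearMap.range_eq_top.2 (modelDeriv_surjective h X), finrank_top,
    finrank_euclideanSpace_fin] at h1
  have h2 := finrank_range_infActLin X.2
  have h3 := Submodule.eq_of_le_of_finrank_eq hle (by omega)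
  rw [h3]
  exact hv

theorem mem_horizontalSpace_iff (h : IsQuotientManifold n r) {X : totalSpace n r}
    {ξ : Cores n r} : ξ ∈ horizontalSpace X ↔
      IsHorizontal (metricCLM X.1) (modelDeriv (QuotientModel n r) proj X) ξ :=
  forall_congr' fun _ => imp_congr (mem_verticalSpace_iff h) Iff.rfl

theorem isHorizontalLift_iff (h : IsQuotientManifold n r) {q : QuotientSpace n r}
    {ξ : TangentSpace 𝓘(ℝ, QuotientModel n r) q} {X : totalSpace n r} {ζ : Cores n r} :
    IsHorizontalLift q ξ X ζ ↔
      IsHorizontal (metricCLM X.1) (modelDeriv (QuotientModel n r) proj X) ζ ∧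
        proj X = q ∧ modelDeriv (QuotientModel n r) proj X ζ = (ξ : QuotientModel n r) :=
  and_congr (mem_horizontalSpace_iff h) tangentMap_eq_mk_iff

theorem existsUnique_horizontalLift (h0 : r 0 = 1) (h1 : r (Fin.last d) = 1)
    (h : IsQuotientManifold n r) (q : QuotientSpace n r)
    (ξ : TangentSpace 𝓘(ℝ, QuotientModel n r) q) (X : totalSpace n r) (hX : proj X = q) :
    ∃! ζ, IsHorizontalLift q ξ X ζ := by
  obtain ⟨ζ, hζ, hζξ⟩ := exists_isHorizontal (posDefForm_metricCLM h0 h1 X)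
    (modelDeriv_surjective h X) (ξ : QuotientModel n r)
  refine ⟨ζ, (isHorizontalLift_iff h).2 ⟨hζ, hX, hζξ⟩, fun η hη => ?_⟩
  obtain ⟨h2, -, h3⟩ := (isHorizontalLift_iff h).1 hη
  exact h2.eq_of_apply_eq (posDefForm_metricCLM h0 h1 X) hζ (h3.trans hζξ.symm)

/-- `theta A` is an isometry from the metric at `X` to that at `Y` and matches the two kernels,
hence preserves orthogonality to them. -/
theorem isHorizontalLift_theta (h : IsQuotientManifold n r) {q : QuotientSpace n r}
    {ξ : TangentSpace 𝓘(ℝ, QuotientModel n r) q} {X Y : totalSpace n r} {A : gaugeGroup r}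
    (hY : Y.1 = theta A X.1) {ζ : Cores n r} (hζ : IsHorizontalLift q ξ X ζ) :
    IsHorizontalLift q ξ Y (theta A ζ) := by
  rw [isHorizontalLift_iff h] at hζ ⊢
  obtain ⟨h2, h3, h4⟩ := hζ
  refine ⟨fun v hv => ?_, ?_, by rw [modelDeriv_theta h A hY, h4]⟩
  · rw [← theta_theta_inv A v] at hv ⊢
    rw [modelDeriv_theta h A hY] at hv
    rw [hY, metricCLM_theta]
    exact h2 _ hv
  · rw [← h3, proj_eq_iff, hY, phi_theta]

theorem isHorizontalLift_iff_eq_theta (h0 : r 0 = 1) (h1 : r (Fin.last d) = 1)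
    (h : IsQuotientManifold n r) {q : QuotientSpace n r}
    {ξ : TangentSpace 𝓘(ℝ, QuotientModel n r) q} {X Y : totalSpace n r} {A : gaugeGroup r}
    (hY : Y.1 = theta A X.1) {ζ : Cores n r} (hζ : IsHorizontalLift q ξ X ζ) (ζ' : Cores n r) :
    IsHorizontalLift q ξ Y ζ' ↔ ζ' = theta A ζ := by
  have h2 := isHorizontalLift_theta h hY hζ
  constructor
  · intro h3
    exact (existsUnique_horizontalLift h0 h1 h q ξ Y ((isHorizontalLift_iff h).1 h2).2.1).unique
      h3 h2
  · rintro rfl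
    exact h2

theorem preMetric_horizontalLift (h0 : r 0 = 1) (h1 : r (Fin.last d) = 1)
    (h : IsQuotientManifold n r) {q : QuotientSpace n r}
    {ξ η : TangentSpace 𝓘(ℝ, QuotientModel n r) q} {X Y : totalSpace n r}
    {ξX ηX ξY ηY : Cores n r} (hξX : IsHorizontalLift q ξ X ξX) (hηX : IsHorizontalLift q η X ηX)
    (hξY : IsHorizontalLift q ξ Y ξY) (hηY : IsHorizontalLift q η Y ηY) :
    preMetric X ξX ηX = preMetric Y ξY ηY := by
  have hXY : proj X = proj Y :=
    ((isHorizontalLift_iff h).1 hξX).2.1.trans ((isHorizontalLift_iff h).1 hξY).2.1.symm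
  obtain ⟨A, hA⟩ := (proj_eq_iff_theta h0 h1).1 hXY
  rw [(isHorizontalLift_iff_eq_theta h0 h1 h hA hξX _).1 hξY,
    (isHorizontalLift_iff_eq_theta h0 h1 h hA hηX _).1 hηY, preMetric_eq, preMetric_eq, hA,
    metricCLM_theta]

theorem existsUnique_metric [IsManifold 𝓘(ℝ, QuotientModel n r) ∞ (QuotientSpace n r)]
    (h0 : r 0 = 1) (h1 : r (Fin.last d) = 1) (h : IsQuotientManifold n r) :
    ∃! g : Bundle.ContMDiffRiemannianMetric 𝓘(ℝ, QuotientModel n r) ∞ (QuotientModel n r)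
        (fun q : QuotientSpace n r => TangentSpace 𝓘(ℝ, QuotientModel n r) q),
      ∀ (q : QuotientSpace n r) (ξ η : TangentSpace 𝓘(ℝ, QuotientModel n r) q)
        (X : totalSpace n r) (ξX ηX : Cores n r),
        IsHorizontalLift q ξ X ξX → IsHorizontalLift q η X ηX →
        g.inner q ξ η = preMetric X ξX ηX := by
  obtain ⟨g, hg⟩ := exists_quotient_metric (F := QuotientModel n r) h.contMDiff_proj
    proj_surjective (modelDeriv_surjective h) (contDiff_metricCLM (n := n) (r := r)).contDiffOn
    (posDefForm_metricCLM h0 h1)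
    (fun X Y hXY => by
      obtain ⟨A, hA⟩ := (proj_eq_iff_theta h0 h1).1 hXY
      refine ⟨theta A, fun Z => ⟨theta A⁻¹ Z, theta_theta_inv A Z⟩, modelDeriv_theta h A hA,
        fun ξ η => ?_⟩
      rw [hA, metricCLM_theta])
  refine ⟨g, fun q ξ η X ξX ηX hξ hη => ?_, fun g' hg' => ?_⟩
  · obtain ⟨h2, rfl, h3⟩ := (isHorizontalLift_iff h).1 hξ
    obtain ⟨h4, -, h5⟩ := (isHorizontalLift_iff h).1 hη
    rw [preMetric_eq, ← hg X ξX ηX h2 h4, h3, h5]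
  -- Every tangent vector of the quotient has a horizontal lift, so the prescribed values determine
  -- the inner product.
  · have key : g'.inner = g.inner := by
      funext q
      ext ξ η
      obtain ⟨X, rfl⟩ := proj_surjective q
      obtain ⟨ξX, hξ, -⟩ := existsUnique_horizontalLift h0 h1 h _ ξ X rfl
      obtain ⟨ηX, hη, -⟩ := existsUnique_horizontalLift h0 h1 h _ η X rfl
      obtain ⟨h2, -, h3⟩ := (isHorizontalLift_iff h).1 hξ
      obtain ⟨h4, -, h5⟩ := (isHorizontalLift_iff h).1 hη
      rw [hg' _ ξ η X ξX ηX hξ hη, preMetric_eq, ← hg X ξX ηX h2 h4, h3, h5]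
    cases g
    cases g'
    congr

end Structure

end TensorTrain

end

theorem mainTheorem5 {d : ℕ} (n : Fin d → ℕ) (r : Fin (d + 1) → ℕ)
    (hr_zero : r 0 = 1) (hr_last : r (Fin.last d) = 1) :
    -- the equivalence classes are the orbits of the group
    (∀ X Y : TensorTrain.totalSpace n r, TensorTrain.proj X = TensorTrain.proj Y ↔
      ∃ A : TensorTrain.gaugeGroup r, Y.1 = TensorTrain.theta A X.1) ∧
    -- the quotient carries the structure of a quotient manifold
    T2Space (TensorTrain.QuotientSpace n r) ∧
    SecondCountableTopology (TensorTrain.QuotientSpace n r) ∧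
    (∃ _ : ChartedSpace (TensorTrain.QuotientModel n r) (TensorTrain.QuotientSpace n r),
      TensorTrain.IsQuotientManifold n r) ∧
    -- and for this structure:
    (∀ [ChartedSpace (TensorTrain.QuotientModel n r) (TensorTrain.QuotientSpace n r)]
        [IsManifold 𝓘(ℝ, TensorTrain.QuotientModel n r) ∞ (TensorTrain.QuotientSpace n r)],
      TensorTrain.IsQuotientManifold n r →
      -- existence and uniqueness of horizontal lifts
      (∀ (q : TensorTrain.QuotientSpace n r)
          (ξ : TangentSpace 𝓘(ℝ, TensorTrain.QuotientModel n r) q)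
          (X : TensorTrain.totalSpace n r), TensorTrain.proj X = q →
          ∃! ξbar, TensorTrain.IsHorizontalLift q ξ X ξbar) ∧
      -- horizontal lifts at equivalent points are related by the group action
      (∀ (q : TensorTrain.QuotientSpace n r)
          (ξ : TangentSpace 𝓘(ℝ, TensorTrain.QuotientModel n r) q)
          (X Y : TensorTrain.totalSpace n r) (A : TensorTrain.gaugeGroup r),
          Y.1 = TensorTrain.theta A X.1 →
          ∀ ξX, TensorTrain.IsHorizontalLift q ξ X ξX →
          ∀ ξY, TensorTrain.IsHorizontalLift q ξ Y ξY ↔ ξY = TensorTrain.theta A ξX) ∧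
      -- the preconditioned metric on horizontal lifts does not depend on the representative
      (∀ (q : TensorTrain.QuotientSpace n r)
          (ξ η : TangentSpace 𝓘(ℝ, TensorTrain.QuotientModel n r) q)
          (X Y : TensorTrain.totalSpace n r) (ξX ηX ξY ηY : TensorTrain.Cores n r),
          TensorTrain.IsHorizontalLift q ξ X ξX → TensorTrain.IsHorizontalLift q η X ηX →
          TensorTrain.IsHorizontalLift q ξ Y ξY → TensorTrain.IsHorizontalLift q η Y ηY →
          TensorTrain.preMetric X ξX ηX = TensorTrain.preMetric Y ξY ηY) ∧
      -- it induces a smooth Riemannian metric on the quotient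
      (∃! g : Bundle.ContMDiffRiemannianMetric 𝓘(ℝ, TensorTrain.QuotientModel n r) ∞
          (TensorTrain.QuotientModel n r)
          (fun q : TensorTrain.QuotientSpace n r =>
            TangentSpace 𝓘(ℝ, TensorTrain.QuotientModel n r) q),
        ∀ (q : TensorTrain.QuotientSpace n r)
          (ξ η : TangentSpace 𝓘(ℝ, TensorTrain.QuotientModel n r) q)
          (X : TensorTrain.totalSpace n r) (ξX ηX : TensorTrain.Cores n r),
          TensorTrain.IsHorizontalLift q ξ X ξX → TensorTrain.IsHorizontalLift q η X ηX →
          g.inner q ξ η = TensorTrain.preMetric X ξX ηX)) := by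
  refine ⟨fun X Y => TensorTrain.proj_eq_iff_theta hr_zero hr_last,
    TensorTrain.t2Space_quotientSpace n r,
    TensorTrain.secondCountable_quotientSpace hr_zero hr_last,
    TensorTrain.exists_isQuotientManifold hr_zero hr_last, ?_⟩
  intro _ _ h
  exact ⟨TensorTrain.existsUnique_horizontalLift hr_zero hr_last h,
    fun q ξ X Y A hY ξX hξX =>
      TensorTrain.isHorizontalLift_iff_eq_theta hr_zero hr_last h hY hξX,
    fun q ξ η X Y ξX ηX ξY ηY =>
      TensorTrain.preMetric_horizontalLift hr_zero hr_last h,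
    TensorTrain.existsUnique_metric hr_zero hr_last h⟩
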